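/- For a complex sequence $(A_m)_{m\in\mathbb Z}$ with $\overline{A_m}=A_{-m}$ and a real sequence $(V_n)\in\ell^\infty(\mathbb Z)$, let $H$ be the operator on $\ell^2(\mathbb Z)$ given by $$(H\psi)_n=\sum_{m\in\mathbb Z}A_m\psi_{n-m}+V_n\psi_n .$$ For a finite interval $I\subset\mathbb Z$ let $|I|$ be its number of points, let $R_I$ be the projection onto $I$, and for $z\notin\mathbb R$ let $G_I(z)=(R_IHR_I-z)^{-1}$ (inverse on $\ell^2(I)$). For $\phi\in\ell^2(\mathbb Z)$, $p>0$ and $T>0$ put $$\langle|X_H|^p_\phi\rangle(T)=\frac2T\int_0^\infty e^{-2t/T}\sum_{n\in\mathbb Z}|n|^p\,\big|(e^{-itH}\phi)_n\big|^2\,dt\in[0,\infty].$$ Let $\phi\in\ell^2(\mathbb Z)$ have finite support, and let $K\ge 3$, $C_1>0$, $0<c_2\le c_1$, $\epsilon_0>0$, $p>0$, $0<\delta<1$, $\varepsilon>0$ and $N_0\in\mathbb N$. Then there is $T_3>0$, depending only on $\phi,K,C_1,c_1,c_2,\epsilon_0,N_0,p,\delta,\varepsilon$, such that the following holds for every $H$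 as above with $$|A_m|\le C_1e^{-c_1|m|}\ (m\in\mathbb Z),\qquad \sigma(H)\subseteq[-K+1,K-1].$$ Suppose that for every $N\in\mathbb Z$ with $|N|\ge N_0$ and every $z=E+i\epsilon$ with $|E|\le K$ and $0<\epsilon\le\epsilon_0$ there is an interval $I$ of integers (which may depend on $N$ and $z$), with $I\subseteq[\frac{|N|}4,\frac{|N|}2]$ if $N>0$ and $I\subseteq[-\frac{|N|}2,-\frac{|N|}4]$ if $N<0$, such that $$|I|\ge(\log|N|)^{1/\delta}\quad(\text{with }\log 0\text{ read as }0)$$ and $$|G_I(z)(m,n)|<e^{-c_2|I|}\quad\text{for all } m,n\in I \text{ with } |m-n|>\tfrac{|I|}{20}.$$ Then for all $T\ge T_3$, $$\langle|X_H|^p_\phi\rangle(T)\le\exp\!\big(p(\log T)^{\delta+\varepsilon}\big).$$ -/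

import Mathlib

open scoped ENNReal

/-- The Hilbert space `ℓ²(ℤ)` of square-summable complex sequences. -/
noncomputable abbrev EllTwo : Type := lp (fun _ : ℤ => ℂ) 2

/-- The Banach space `ℓ^∞(ℤ)` of bounded real sequences. -/
noncomputable abbrev EllInftyReal : Type := lp (fun _ : ℤ => ℝ) ∞

theorem EllTwo.summable_sq (ψ : EllTwo) : Summable fun n : ℤ => ‖ψ n‖ ^ 2 := by
  have h := (lp.memℓp ψ).summable (by simp)
  simpa using h

theorem EllTwo.norm_sq (ψ : EllTwo) : ‖ψ‖ ^ 2 = ∑' n : ℤ, ‖ψ n‖ ^ 2 := by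
  have h := lp.norm_rpow_eq_tsum (p := 2) (by simp) ψ
  simpa using h

theorem memEllTwo_of_summable {f : ℤ → ℂ} (h : Summable fun n : ℤ => ‖f n‖ ^ 2) :
    Memℓp f 2 :=
  memℓp_gen (by simpa using h)

/-- The translation `(S_m ψ)_n = ψ_{n-m}` on `ℓ²(ℤ)`. -/
noncomputable def shiftOp (m : ℤ) : EllTwo →L[ℂ] EllTwo :=
  LinearMap.mkContinuous
    { toFun := fun ψ => ⟨fun n => ψ (n - m), memEllTwo_of_summable
        ((Equiv.subRight m).summable_iff.mpr ψ.summable_sq)⟩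
      map_add' := fun _ _ => rfl
      map_smul' := fun _ _ => rfl } 1
    (fun ψ => by
      rw [one_mul, ← sq_le_sq₀ (norm_nonneg _) (norm_nonneg _), EllTwo.norm_sq, EllTwo.norm_sq]
      exact ((Equiv.subRight m).tsum_eq (fun n : ℤ => ‖ψ n‖ ^ 2)).le)

/-- Multiplication `(Vψ)_n = V_n ψ_n` by a bounded real sequence. -/
noncomputable def potentialOp (V : EllInftyReal) : EllTwo →L[ℂ] EllTwo :=
  have key : ∀ (ψ : EllTwo) (n : ℤ), ‖(V n : ℂ) * ψ n‖ ^ 2 ≤ ‖V‖ ^ 2 * ‖ψ n‖ ^ 2 := fun ψ n => by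
    rw [norm_mul, mul_pow, Complex.norm_real]
    gcongr
    exact lp.norm_apply_le_norm (by simp) V n
  LinearMap.mkContinuous
    { toFun := fun ψ => ⟨fun n => (V n : ℂ) * ψ n, memEllTwo_of_summable
        (Summable.of_nonneg_of_le (fun _ => by positivity) (key ψ)
          (ψ.summable_sq.mul_left _))⟩
      map_add' := fun ψ χ => by
        ext n
        exact mul_add _ _ _
      map_smul' := fun c ψ => by
        ext n
        exact mul_left_comm _ _ _ } ‖V‖
    (fun ψ => by
      rw [← sq_le_sq₀ (norm_nonneg _) (by positivity), mul_pow, EllTwo.norm_sq, EllTwo.norm_sq,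
        ← tsum_mul_left]
      exact Summable.tsum_le_tsum (key ψ)
        (Summable.of_nonneg_of_le (fun _ => by positivity) (key ψ)
          (ψ.summable_sq.mul_left _)) (ψ.summable_sq.mul_left _))

/-- The long-range operator `(Hψ)_n = ∑_m A_m ψ_{n-m} + V_n ψ_n` on `ℓ²(ℤ)`. The series
`∑_m A_m S_m` converges in operator norm as soon as `A` is absolutely summable. -/
noncomputable def longRangeOp (A : ℤ → ℂ) (V : EllInftyReal) : EllTwo →L[ℂ] EllTwo :=
  (∑' m : ℤ, A m • shiftOp m) + potentialOp V

theorem norm_shiftOp_le (m : ℤ) : ‖shiftOp m‖ ≤ 1 :=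
  LinearMap.mkContinuous_norm_le _ zero_le_one _

/-- For absolutely summable `A` the operator is given by the expected formula, and the sum
in this formula converges. -/
theorem longRangeOp_apply (A : ℤ → ℂ) (hA : Summable fun m => ‖A m‖) (V : EllInftyReal)
    (ψ : EllTwo) (n : ℤ) :
    HasSum (fun m : ℤ => A m * ψ (n - m)) ((longRangeOp A V ψ) n - (V n : ℂ) * ψ n) := by
  have hs : Summable fun m : ℤ => A m • shiftOp m := by
    refine Summable.of_norm_bounded hA fun m => ?_
    rw [norm_smul]
    exact mul_le_of_le_one_right (norm_nonneg _) (norm_shiftOp_le m)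
  have h1 := (ContinuousLinearMap.apply ℂ EllTwo ψ).hasSum hs.hasSum
  have h2 := (lp.evalCLM ℂ (fun _ : ℤ => ℂ) 2 n).hasSum h1
  have h3 : (longRangeOp A V ψ) n - (V n : ℂ) * ψ n
      = (lp.evalCLM ℂ (fun _ : ℤ => ℂ) 2 n)
        ((ContinuousLinearMap.apply ℂ EllTwo ψ) (∑' m : ℤ, A m • shiftOp m)) := by
    change ((∑' m : ℤ, A m • shiftOp m) ψ) n + (V n : ℂ) * ψ n - (V n : ℂ) * ψ n = _
    rw [add_sub_cancel_right]
    rfl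
  rw [h3]
  exact h2

/-- The finite matrix of the restriction `R_I H R_I` to `I`: its entries are the matrix
elements `⟨δ_m, H δ_n⟩ = A_{m-n} + V_n δ_{mn}` with `m, n ∈ I`. -/
noncomputable def restrictedMatrix (A : ℤ → ℂ) (V : EllInftyReal) (I : Finset ℤ) :
    Matrix I I ℂ :=
  fun m n => A ((m : ℤ) - (n : ℤ)) + if m = n then ((V (n : ℤ) : ℝ) : ℂ) else 0

/-- The Green's function `G_I(z) = (R_I H R_I - z)⁻¹` of the restriction to `I`. -/
noncomputable def greenMatrix (A : ℤ → ℂ) (V : EllInftyReal) (I : Finset ℤ) (z : ℂ) :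
    Matrix I I ℂ :=
  (restrictedMatrix A V I - z • (1 : Matrix I I ℂ))⁻¹

/-- The solution `ψ(t) = e^{-itH} φ` of the Schrödinger equation. -/
noncomputable def schrodingerEvolution (H : EllTwo →L[ℂ] EllTwo) (φ : EllTwo) (t : ℝ) : EllTwo :=
  NormedSpace.exp ((-(Complex.I * (t : ℂ))) • H) φ

/-- The time-averaged `p`-th moment
`(2/T) ∫_0^∞ e^{-2t/T} ⟨ψ(t), |X|^p ψ(t)⟩ dt`, with
`⟨ψ, |X|^p ψ⟩ = ∑_n |n|^p |ψ_n|²`, as an element of `[0, ∞]`. -/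
noncomputable def averagedMoment (H : EllTwo →L[ℂ] EllTwo) (φ : EllTwo) (p T : ℝ) : ℝ≥0∞ :=
  ENNReal.ofReal (2 / T) * ∫⁻ t in Set.Ioi (0 : ℝ), ENNReal.ofReal (Real.exp (-2 * t / T)) *
    ∑' n : ℤ, ENNReal.ofReal (|(n : ℝ)| ^ p * ‖schrodingerEvolution H φ t n‖ ^ 2)

/-- `I` is a finite interval of integers contained in `[|N|/4, |N|/2]` if `N > 0`, and in
`[-|N|/2, -|N|/4]` if `N < 0`; that is, it lies between the origin and `N`. -/
def IsIntervalTowards (N : ℤ) (I : Finset ℤ) : Prop :=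
  (∃ a b : ℤ, I = Finset.Icc a b) ∧
  (0 < N → ∀ k ∈ I, |(N : ℝ)| / 4 ≤ (k : ℝ) ∧ (k : ℝ) ≤ |(N : ℝ)| / 2) ∧
  (N < 0 → ∀ k ∈ I, -(|(N : ℝ)| / 2) ≤ (k : ℝ) ∧ (k : ℝ) ≤ -(|(N : ℝ)| / 4))

/-- Decay of the Green's function of the restriction to `I`, at the energy `z` and rate `c`:
`|G_I(z)(m,n)| < e^{-c|I|}` for all `m, n ∈ I` with `|m-n| > |I|/20`. -/
def GreenDecay (A : ℤ → ℂ) (V : EllInftyReal) (I : Finset ℤ) (z : ℂ) (c : ℝ) : Prop :=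
  ∀ m n : I, (I.card : ℝ) / 20 < |((m : ℤ) : ℝ) - ((n : ℤ) : ℝ)| →
    ‖greenMatrix A V I z m n‖ < Real.exp (-c * (I.card : ℝ))

/-! Put `η = 1/T` and `u = (H - E - iη)⁻¹φ`. By Plancherel in time, the time average of `|ψ_n|²` is
an integral over energies `E` of `|u_n|²`, so it suffices to bound `u` far from the origin by a
multiple of `1/(1+E²)`, which is integrable.

For `|E| ≤ K` there is a good interval `I` between the origin and `N`. Expressing `u` on `I` through
its values outside `I` makes `u` small in the core of `I` (`norm_apply_le_of_greenDecay`). Beyond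
the centre of `I` no Green's function is known; there self-adjointness helps: the mass of `u` on
that half-line, times `η`, is at most a flux through the centre, and the flux is controlled by `u`
near the centre (`im_mul_norm_sq_mask_le`). This gives `|u_N|² ≲ T⁵ e^{-c|I|}`. For `|E| ≥ K` the
energy is at distance at least 1 from the spectrum and a Combes-Thomas estimate gives exponential
decay (`norm_apply_le_of_combesThomas`).

With `|I| ≥ (log|N|)^{1/δ}` the factor `T⁵` is absorbed once `log|N|` exceeds about `(log T)^{δ+ε}`,
because `(δ+ε)/δ > 1`. Sites beyond this scale contribute at most 1 to the moment; sites below it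
contribute at most the `p`-th power of the scale times `‖φ‖²`. All constants are chosen before `A`
and `V`. -/

section LongRange

open scoped InnerProductSpace ComplexConjugate

/-! ### Plancherel's theorem for the integral Fourier transform -/

section Plancherel
open MeasureTheory FourierTransform SchwartzMap
open scoped ContDiff

theorem integral_schwartz_smul_fourier {f : ℝ → ℂ} (hf : Integrable f) (g : 𝓢(ℝ, ℂ)) :
    ∫ x, g x • 𝓕 f x = ∫ x, (𝓕 g) x • f x := by
  have h := VectorFourier.integral_fourierIntegral_smul_eq_flip (L := innerₗ ℝ)
    (μ := volume) (ν := volume) (f := g) (g := f)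
    Real.continuous_fourierChar continuous_inner g.integrable hf
  rw [flip_innerₗ] at h
  exact h.symm

theorem integral_schwartz_smul_fourier_Lp (F : Lp ℂ 2 (volume : Measure ℝ)) (g : 𝓢(ℝ, ℂ)) :
    ∫ x, g x • (𝓕 F : Lp ℂ 2 (volume : Measure ℝ)) x = ∫ x, (𝓕 g) x • F x := by
  have h1 := DFunLike.congr_fun (Lp.fourier_toTemperedDistribution_eq F) g
  rw [TemperedDistribution.fourier_apply, Lp.toTemperedDistribution_apply,
    Lp.toTemperedDistribution_apply] at h1
  exact h1.symm

theorem Lp_ae_eq_of_integral_schwartz_smul_eq (F : Lp ℂ 2 (volume : Measure ℝ)) {f : ℝ → ℂ}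
    (hf : LocallyIntegrable f)
    (h : ∀ g : 𝓢(ℝ, ℂ), ∫ x, g x • F x = ∫ x, g x • f x) : F =ᵐ[volume] f := by
  refine ae_eq_of_integral_contDiff_smul_eq
    ((Lp.memLp F).locallyIntegrable (by norm_num)) hf fun g hg hgs => ?_
  have hgs' : HasCompactSupport (fun x => (g x : ℂ)) := 
    hgs.comp_left (g := Complex.ofReal) Complex.ofReal_zero
  have hg' : ContDiff ℝ ∞ (fun x => (g x : ℂ)) := Complex.ofRealCLM.contDiff.comp hg
  exact h (hgs'.toSchwartzMap hg')

/-- Both the `L²` transform and the integral transform pass to the test function when paired with a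
Schwartz function, so they agree almost everywhere. The `L²` isometry thus applies to the integral.
-/
theorem fourier_toLp_ae_eq {f : ℝ → ℂ} (hf : Integrable f) (F : Lp ℂ 2 (volume : Measure ℝ))
    (hF : F =ᵐ[volume] f) :
    ((𝓕 F : Lp ℂ 2 (volume : Measure ℝ)) : ℝ → ℂ) =ᵐ[volume] 𝓕 f := by
  have hcont : Continuous (𝓕 f) :=
    VectorFourier.fourierIntegral_continuous Real.continuous_fourierChar continuous_inner hf
  refine Lp_ae_eq_of_integral_schwartz_smul_eq _ hcont.locallyIntegrable fun g => ?_
  rw [integral_schwartz_smul_fourier_Lp, integral_schwartz_smul_fourier hf]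
  exact integral_congr_ae (by filter_upwards [hF] with x hx; rw [hx])

/-- Plancherel's theorem on `L¹ ∩ L²`. -/
theorem lintegral_enorm_sq_fourier {f : ℝ → ℂ} (hf : Integrable f) (hf₂ : MemLp f 2) :
    ∫⁻ x, ‖𝓕 f x‖ₑ ^ 2 = ∫⁻ x, ‖f x‖ₑ ^ 2 := by
  have key : ∀ g : ℝ → ℂ, ∫⁻ x, ‖g x‖ₑ ^ 2 = eLpNorm g 2 volume ^ 2 := fun g => by
    rw [eLpNorm_eq_lintegral_rpow_enorm_toReal (by norm_num) (by norm_num),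
      ← ENNReal.rpow_natCast, ← ENNReal.rpow_mul]
    simp
  rw [key, key, ← eLpNorm_congr_ae (fourier_toLp_ae_eq hf hf₂.toLp hf₂.coeFn_toLp)]
  have h := Lp.norm_fourier_eq hf₂.toLp
  rw [Lp.norm_def, Lp.norm_def, ENNReal.toReal_eq_toReal_iff' (Lp.eLpNorm_ne_top _)
    (Lp.eLpNorm_ne_top _), eLpNorm_congr_ae hf₂.coeFn_toLp] at h
  rw [h]

end Plancherel

/-! ### Self-adjointness of the operator and the unitary evolution -/

@[simp] theorem shiftOp_apply (m : ℤ) (ψ : EllTwo) (n : ℤ) : shiftOp m ψ n = ψ (n - m) := rfl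

@[simp] theorem potentialOp_apply (V : EllInftyReal) (ψ : EllTwo) (n : ℤ) :
    potentialOp V ψ n = (V n : ℂ) * ψ n := rfl

theorem star_shiftOp (m : ℤ) : star (shiftOp m) = shiftOp (-m) := by
  rw [ContinuousLinearMap.star_eq_adjoint]
  symm
  rw [ContinuousLinearMap.eq_adjoint_iff]
  intro x y
  rw [lp.inner_eq_tsum, lp.inner_eq_tsum]
  rw [← (Equiv.subRight m).tsum_eq]
  simp

theorem isSelfAdjoint_potentialOp (V : EllInftyReal) : IsSelfAdjoint (potentialOp V) := by
  rw [ContinuousLinearMap.isSelfAdjoint_iff_isSymmetric]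
  intro x y
  change ⟪potentialOp V x, y⟫_ℂ = ⟪x, potentialOp V y⟫_ℂ
  rw [lp.inner_eq_tsum, lp.inner_eq_tsum]
  refine tsum_congr fun n => ?_
  simp only [potentialOp_apply, RCLike.inner_apply, map_mul, Complex.conj_ofReal]
  ring

theorem isSelfAdjoint_longRangeOp {A : ℤ → ℂ} (hA : ∀ m, conj (A m) = A (-m))
    (V : EllInftyReal) : IsSelfAdjoint (longRangeOp A V) := by
  refine IsSelfAdjoint.add ?_ (isSelfAdjoint_potentialOp V)
  rw [isSelfAdjoint_iff, tsum_star, ← (Equiv.neg ℤ).tsum_eq]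
  refine tsum_congr fun m => ?_
  rw [star_smul, star_shiftOp]
  simp [← hA]

theorem norm_le_of_spectrum_subset {H : EllTwo →L[ℂ] EllTwo} (hH : IsSelfAdjoint H) {K : ℝ}
    (hK : 0 ≤ K) (h : spectrum ℂ H ⊆ (fun x : ℝ => (x : ℂ)) '' Set.Icc (-K) K) : ‖H‖ ≤ K := by
  have h1 : spectralRadius ℂ H ≤ ENNReal.ofReal K := by
    refine iSup₂_le fun k hk => ?_
    obtain ⟨x, hx, rfl⟩ := h hk
    change ‖(x : ℂ)‖ₑ ≤ _
    rw [← ofReal_norm, Complex.norm_real]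
    exact ENNReal.ofReal_le_ofReal (abs_le.2 hx)
  rw [hH.spectralRadius_eq_nnnorm] at h1
  change ‖H‖ₑ ≤ _ at h1
  rw [← ofReal_norm] at h1
  exact (ENNReal.ofReal_le_ofReal_iff hK).1 h1

theorem norm_schrodingerEvolution {H : EllTwo →L[ℂ] EllTwo} (hH : IsSelfAdjoint H) (φ : EllTwo)
    (t : ℝ) : ‖schrodingerEvolution H φ t‖ = ‖φ‖ := by
  have h1 : (-(Complex.I * (t : ℂ))) • H ∈ skewAdjoint (EllTwo →L[ℂ] EllTwo) := by
    refine hH.smul_mem_skewAdjoint ?_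
    rw [skewAdjoint.mem_iff]
    simp
  let _ := NormedAlgebra.restrictScalars ℚ ℂ (EllTwo →L[ℂ] EllTwo)
  have h2 := NormedSpace.exp_mem_unitary_of_mem_skewAdjoint h1
  exact ContinuousLinearMap.norm_map_of_mem_unitary h2 φ

theorem hasDerivAt_schrodingerEvolution (H : EllTwo →L[ℂ] EllTwo) (φ : EllTwo) (t : ℝ) :
    HasDerivAt (schrodingerEvolution H φ) (-Complex.I • H (schrodingerEvolution H φ t)) t := by
  have h1 := hasDerivAt_exp_smul_const' (𝕂 := ℝ) (-Complex.I • H) t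
  have h2 := ((ContinuousLinearMap.apply ℂ EllTwo φ).restrictScalars ℝ).hasFDerivAt.comp_hasDerivAt
    t h1
  have h3 : ∀ s : ℝ, (-(Complex.I * (s : ℂ))) • H = s • (-Complex.I • H) := fun s => by
    rw [mul_comm, ← mul_neg, mul_smul]
    exact Complex.coe_smul s _
  have h4 : schrodingerEvolution H φ = ((ContinuousLinearMap.apply ℂ EllTwo φ).restrictScalars ℝ) ∘
      fun s : ℝ => NormedSpace.exp (s • (-Complex.I • H)) := by
    funext s
    rw [schrodingerEvolution, h3]
    rfl
  rw [h4]
  exact h2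

theorem continuous_schrodingerEvolution (H : EllTwo →L[ℂ] EllTwo) (φ : EllTwo) :
    Continuous (schrodingerEvolution H φ) :=
  continuous_iff_continuousAt.2 fun t => (hasDerivAt_schrodingerEvolution H φ t).continuousAt

/-! ### The resolvent as a Laplace transform -/

/-- The vector `(H - z)⁻¹ φ` for `Im z > 0`, written as the Laplace transform of the evolution. -/
noncomputable def laplaceVector (H : EllTwo →L[ℂ] EllTwo) (φ : EllTwo) (z : ℂ) : EllTwo :=
  Complex.I • ∫ t in Set.Ioi (0 : ℝ), Complex.exp (Complex.I * z * t) • schrodingerEvolution H φ t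

theorem norm_laplace_integrand {H : EllTwo →L[ℂ] EllTwo} (hH : IsSelfAdjoint H) (φ : EllTwo)
    (z : ℂ) (t : ℝ) :
    ‖Complex.exp (Complex.I * z * t) • schrodingerEvolution H φ t‖
      = Real.exp (-z.im * t) * ‖φ‖ := by
  rw [norm_smul, norm_schrodingerEvolution hH, Complex.norm_exp]
  simp

theorem continuous_laplace_integrand (H : EllTwo →L[ℂ] EllTwo) (φ : EllTwo) (z : ℂ) :
    Continuous fun t : ℝ => Complex.exp (Complex.I * z * t) • schrodingerEvolution H φ t := by
  have := continuous_schrodingerEvolution H φ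
  fun_prop

theorem integrableOn_laplace_integrand {H : EllTwo →L[ℂ] EllTwo} (hH : IsSelfAdjoint H)
    (φ : EllTwo) {z : ℂ} (hz : 0 < z.im) :
    MeasureTheory.IntegrableOn
      (fun t : ℝ => Complex.exp (Complex.I * z * t) • schrodingerEvolution H φ t)
      (Set.Ioi (0 : ℝ)) := by
  refine MeasureTheory.Integrable.mono' ((exp_neg_integrableOn_Ioi 0 hz).mul_const ‖φ‖)
    (continuous_laplace_integrand H φ z).aestronglyMeasurable ?_
  exact Filter.Eventually.of_forall fun t => (norm_laplace_integrand hH φ z t).le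

/-- The integrand solves `F' = i(z - H)F` and vanishes at infinity because `Im z > 0`; integrating
`F'` over the half-line leaves `-F(0) = -φ`. -/
theorem apply_laplaceVector {H : EllTwo →L[ℂ] EllTwo} (hH : IsSelfAdjoint H)
    (φ : EllTwo) {z : ℂ} (hz : 0 < z.im) :
    H (laplaceVector H φ z) - z • laplaceVector H φ z = φ := by
  set F : ℝ → EllTwo := fun t => Complex.exp (Complex.I * z * t) • schrodingerEvolution H φ t
  set B : EllTwo →L[ℂ] EllTwo := (Complex.I * z) • 1 - Complex.I • H
  have hd : ∀ t : ℝ, HasDerivAt F (B (F t)) t := fun t => by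
    have h1 : HasDerivAt (fun t : ℝ => Complex.exp (Complex.I * z * t))
        (Complex.exp (Complex.I * z * t) * (Complex.I * z)) t := by
      have := ((hasDerivAt_id (t : ℂ)).const_mul (Complex.I * z)).cexp.comp_ofReal
      simpa using this
    refine (h1.smul (hasDerivAt_schrodingerEvolution H φ t)).congr_deriv ?_
    simp only [B, F, sub_apply, smul_apply,
      one_apply_eq_self, map_smul]
    module
  have hi := integrableOn_laplace_integrand hH φ hz
  have h0 : Filter.Tendsto F Filter.atTop (nhds 0) := by
    rw [tendsto_zero_iff_norm_tendsto_zero]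
    simp only [F, norm_laplace_integrand hH]
    have h1 : Filter.Tendsto (fun t : ℝ => -z.im * t) Filter.atTop Filter.atBot :=
      Filter.tendsto_id.const_mul_atTop_of_neg (by linarith)
    simpa using (Real.tendsto_exp_atBot.comp h1).mul_const ‖φ‖
  have h1 := MeasureTheory.integral_Ioi_of_hasDerivAt_of_tendsto' (a := 0) (fun t _ => hd t)
    (B.integrable_comp hi) h0
  rw [B.integral_comp_comm hi] at h1
  have hF0 : F 0 = φ := by simp [F, schrodingerEvolution]
  rw [hF0, zero_sub] at h1
  have h2 : H (laplaceVector H φ z) - z • laplaceVector H φ z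
      = -B (∫ t in Set.Ioi (0 : ℝ), F t) := by
    simp only [B, laplaceVector, map_smul, sub_apply,
      smul_apply, one_apply_eq_self]
    module
  rw [h2, h1, neg_neg]

theorem im_inner_sub_smul {H : EllTwo →L[ℂ] EllTwo} (hH : IsSelfAdjoint H) (w : EllTwo) (z : ℂ) :
    (⟪w, H w - z • w⟫_ℂ).im = -z.im * ‖w‖ ^ 2 := by
  have h1 : (⟪w, H w⟫_ℂ).im = 0 := by
    have h := ((ContinuousLinearMap.isSelfAdjoint_iff_isSymmetric.1 hH) w w)
    have h2 := inner_conj_symm (𝕜 := ℂ) w (H w)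
    change ⟪H w, w⟫_ℂ = ⟪w, H w⟫_ℂ at h
    rw [h] at h2
    exact Complex.conj_eq_iff_im.1 h2
  rw [inner_sub_right, inner_smul_right, inner_self_eq_norm_sq_to_K, Complex.sub_im, h1]
  change 0 - (z * (‖w‖ : ℂ) ^ 2).im = _
  rw [← Complex.ofReal_pow, Complex.im_mul_ofReal]
  ring

theorem norm_le_of_apply_sub_smul {H : EllTwo →L[ℂ] EllTwo} (hH : IsSelfAdjoint H)
    {u φ : EllTwo} {z : ℂ} (hz : 0 < z.im) (h : H u - z • u = φ) : ‖u‖ ≤ ‖φ‖ / z.im := by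
  rw [le_div_iff₀ hz]
  rcases (norm_nonneg u).eq_or_lt with h0 | h0
  · rw [← h0, zero_mul]; positivity
  have h1 := im_inner_sub_smul hH u z
  rw [h] at h1
  have h2 : z.im * ‖u‖ ^ 2 ≤ ‖u‖ * ‖φ‖ := by
    calc z.im * ‖u‖ ^ 2 = |(⟪u, φ⟫_ℂ).im| := by
          rw [h1, abs_mul, abs_neg, abs_of_pos hz, abs_of_nonneg (by positivity)]
      _ ≤ ‖⟪u, φ⟫_ℂ‖ := Complex.abs_im_le_norm _
      _ ≤ _ := norm_inner_le_norm _ _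
  refine le_of_mul_le_mul_left ?_ h0
  linarith [h2, sq (‖u‖)]

/-! ### Sums against the hopping kernel -/

/-- The sum `∑_m e^{-c|m|}` over the integers. -/
noncomputable def expSum (c : ℝ) : ℝ := ∑' m : ℤ, Real.exp (-c * |(m : ℝ)|)

theorem summable_exp_neg_abs {c : ℝ} (hc : 0 < c) :
    Summable fun m : ℤ => Real.exp (-c * |(m : ℝ)|) := by
  have h : Summable fun n : ℕ => Real.exp (-c * |(n : ℝ)|) := by
    have := Real.summable_exp_nat_mul_iff.2 (neg_lt_zero.2 hc)
    refine this.congr fun n => ?_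
    rw [Nat.abs_cast, mul_comm]
  exact Summable.of_nat_of_neg (by simpa using h) (by simpa using h)

theorem summable_exp_neg_abs_sub {c : ℝ} (hc : 0 < c) (k : ℤ) :
    Summable fun m : ℤ => Real.exp (-c * |(m : ℝ) - k|) := by
  refine ((Equiv.subRight k).summable_iff.2 (summable_exp_neg_abs hc)).congr fun m => ?_
  simp

theorem tsum_exp_neg_abs_sub (c : ℝ) (k : ℤ) :
    ∑' m : ℤ, Real.exp (-c * |(m : ℝ) - k|) = expSum c := by
  rw [expSum, ← (Equiv.subRight k).tsum_eq (fun m : ℤ => Real.exp (-c * |(m : ℝ)|))]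
  simp

theorem expSum_nonneg (c : ℝ) : 0 ≤ expSum c := tsum_nonneg fun _ => (Real.exp_pos _).le

section Hopping

variable {A : ℤ → ℂ} {C₁ c₁ : ℝ}

theorem summable_norm_hopping (hc₁ : 0 < c₁)
    (hA : ∀ m : ℤ, ‖A m‖ ≤ C₁ * Real.exp (-c₁ * |(m : ℝ)|)) : Summable fun m => ‖A m‖ :=
  Summable.of_nonneg_of_le (fun _ => norm_nonneg _) hA ((summable_exp_neg_abs hc₁).mul_left _)

theorem hasSum_longRangeOp (hA : Summable fun m => ‖A m‖) (V : EllInftyReal) (u : EllTwo)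
    (n : ℤ) :
    HasSum (fun l : ℤ => A (n - l) * u l) (longRangeOp A V u n - (V n : ℂ) * u n) := by
  have h := longRangeOp_apply A hA V u n
  rw [← (Equiv.subLeft n).hasSum_iff] at h
  simpa [Function.comp_def] using h

/-- Sums against the hopping kernel over sites at distance at least `d` are exponentially small. -/
theorem norm_hopping_mul_le (hC₁ : 0 ≤ C₁) (hc₁ : 0 < c₁)
    (hA : ∀ m : ℤ, ‖A m‖ ≤ C₁ * Real.exp (-c₁ * |(m : ℝ)|)) {v : ℤ → ℂ} {B d : ℝ}
    (hv : ∀ l, ‖v l‖ ≤ B) {k : ℤ} (hd : ∀ l, v l ≠ 0 → d ≤ |(k : ℝ) - l|) :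
    ‖∑' l : ℤ, A (k - l) * v l‖ ≤ C₁ * expSum (c₁ / 2) * B * Real.exp (-(c₁ / 2) * d) := by
  have h1 := ((summable_exp_neg_abs_sub (half_pos hc₁) k).hasSum).mul_left
    (C₁ * Real.exp (-(c₁ / 2) * d) * B)
  rw [tsum_exp_neg_abs_sub] at h1
  refine (tsum_of_norm_bounded h1 fun l => ?_).trans (le_of_eq (by ring))
  have hB : 0 ≤ B := (norm_nonneg _).trans (hv l)
  by_cases h0 : v l = 0
  · rw [h0, mul_zero, norm_zero]; positivity
  rw [norm_mul]
  have h2 := hA (k - l)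
  -- Half of the decay rate pays for the distance `d`; the other half keeps the sum over `l` finite.
  have h3 : Real.exp (-c₁ * |((k - l : ℤ) : ℝ)|)
      ≤ Real.exp (-(c₁ / 2) * d) * Real.exp (-(c₁ / 2) * |(l : ℝ) - k|) := by
    rw [← Real.exp_add, Real.exp_le_exp]
    have := hd l h0
    push_cast
    rw [abs_sub_comm (l : ℝ)]
    nlinarith
  calc ‖A (k - l)‖ * ‖v l‖
      ≤ (C₁ * (Real.exp (-(c₁ / 2) * d) * Real.exp (-(c₁ / 2) * |(l : ℝ) - k|))) * B := by
        gcongr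
        · exact h2.trans (by gcongr)
        · exact hv l
    _ = _ := by ring

end Hopping

/-! ### Green's functions of finite restrictions -/

section Green

/-- The quadratic form of `M` is real. The right side is left as a sum so that, for `x` a column of
the inverse, a single term survives. -/
theorem Matrix.IsHermitian.abs_im_mul_sum_le {ι : Type*} [Fintype ι] [DecidableEq ι]
    {M : Matrix ι ι ℂ} (hM : M.IsHermitian) (z : ℂ) (x : ι → ℂ) :
    |z.im| * ∑ i, ‖x i‖ ^ 2 ≤ ∑ i, ‖x i‖ * ‖((M - z • (1 : Matrix ι ι ℂ)).mulVec x) i‖ := by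
  have h1 : (dotProduct (star x) (M.mulVec x)).im = 0 := hM.im_star_dotProduct_mulVec_self x
  have h2 : dotProduct (star x) x = ((∑ i, ‖x i‖ ^ 2 : ℝ) : ℂ) := by
    simp [dotProduct, Complex.conj_mul']
  have h3 : (dotProduct (star x) ((M - z • (1 : Matrix ι ι ℂ)).mulVec x)).im
      = -(z.im * ∑ i, ‖x i‖ ^ 2) := by
    rw [Matrix.sub_mulVec, dotProduct_sub, Matrix.smul_mulVec, Matrix.one_mulVec,
      dotProduct_smul, h2, Complex.sub_im, h1, smul_eq_mul, Complex.im_mul_ofReal, zero_sub]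
  calc |z.im| * ∑ i, ‖x i‖ ^ 2
      = |(dotProduct (star x) ((M - z • (1 : Matrix ι ι ℂ)).mulVec x)).im| := by
        rw [h3, abs_neg, abs_mul,
          abs_of_nonneg (Finset.sum_nonneg fun i _ => sq_nonneg ‖x i‖)]
    _ ≤ _ := (Complex.abs_im_le_norm _).trans ((norm_sum_le _ _).trans_eq (by simp))

theorem Matrix.IsHermitian.isUnit_det_sub_smul {ι : Type*} [Fintype ι] [DecidableEq ι]
    {M : Matrix ι ι ℂ} (hM : M.IsHermitian) {z : ℂ} (hz : z.im ≠ 0) :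
    IsUnit (M - z • (1 : Matrix ι ι ℂ)).det := by
  rw [isUnit_iff_ne_zero]
  intro h
  obtain ⟨x, hx, hx0⟩ := Matrix.exists_mulVec_eq_zero_iff.2 h
  have h1 := hM.abs_im_mul_sum_le z x
  rw [hx0] at h1
  simp only [Pi.zero_apply, norm_zero, mul_zero, Finset.sum_const_zero] at h1
  have h2 : ∑ i, ‖x i‖ ^ 2 ≤ 0 := by
    by_contra! h
    have := mul_pos (abs_pos.2 hz) h
    linarith
  refine hx (funext fun i => ?_)
  have h3 := (Finset.single_le_sum (fun i _ => by positivity) (Finset.mem_univ i)).trans h2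
  simpa using h3

/-- For the `k`-th column `x` of the inverse, `|Im z| ∑ ‖x i‖² ≤ ‖x k‖`. This bounds `‖x k‖` first,
and then every other entry. -/
theorem Matrix.IsHermitian.norm_inv_sub_smul_apply_le {ι : Type*} [Fintype ι] [DecidableEq ι]
    {M : Matrix ι ι ℂ} (hM : M.IsHermitian) {z : ℂ} (hz : z.im ≠ 0) (m k : ι) :
    ‖(M - z • (1 : Matrix ι ι ℂ))⁻¹ m k‖ ≤ 1 / |z.im| := by
  set G := (M - z • (1 : Matrix ι ι ℂ))⁻¹
  set x : ι → ℂ := fun i => G i k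
  have hz' : 0 < |z.im| := abs_pos.2 hz
  have hx : (M - z • (1 : Matrix ι ι ℂ)).mulVec x = Pi.single k 1 := by
    have h : x = G.mulVec (Pi.single k 1) := by rw [Matrix.mulVec_single_one]; rfl
    rw [h, Matrix.mulVec_mulVec, Matrix.mul_nonsing_inv _ (hM.isUnit_det_sub_smul hz),
      Matrix.one_mulVec]
  have h1 := hM.abs_im_mul_sum_le z x
  rw [hx] at h1
  have h2 : ∑ i, ‖x i‖ * ‖(Pi.single k (1 : ℂ) : ι → ℂ) i‖ = ‖x k‖ := by
    rw [Finset.sum_eq_single k]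
    · simp
    · intro i _ hi; simp [hi]
    · simp
  rw [h2] at h1
  have h3 : ∀ i, |z.im| * ‖x i‖ ^ 2 ≤ ‖x k‖ := fun i => le_trans (by
    gcongr
    exact Finset.single_le_sum (f := fun i => ‖x i‖ ^ 2) (fun i _ => by positivity)
      (Finset.mem_univ i)) h1
  have h4 : ‖x k‖ ≤ 1 / |z.im| := by
    rw [le_div_iff₀ hz']
    by_contra! h
    have h5 : 0 < ‖x k‖ := by
      by_contra! h6
      nlinarith [norm_nonneg (x k)]
    nlinarith [h3 k]
  change ‖x m‖ ≤ _
  have h5 : ‖x m‖ ^ 2 ≤ (1 / |z.im|) ^ 2 := by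
    have h6 : ‖x m‖ ^ 2 ≤ (1 / |z.im|) / |z.im| := by
      rw [le_div_iff₀ hz', mul_comm]
      exact (h3 m).trans h4
    exact h6.trans_eq (by ring)
  exact (sq_le_sq₀ (norm_nonneg _) (by positivity)).1 h5

variable {A : ℤ → ℂ}

theorem isHermitian_restrictedMatrix (hA : ∀ m, conj (A m) = A (-m)) (V : EllInftyReal)
    (I : Finset ℤ) : (restrictedMatrix A V I).IsHermitian := by
  ext m n
  simp only [Matrix.conjTranspose_apply, restrictedMatrix, star_add, RCLike.star_def, hA, neg_sub]
  congr 1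
  by_cases h : m = n
  · simp [h]
  · simp [h, Ne.symm h]

/-- Inside `I` a solution of `(H - z) u = 0` is determined by its values outside of `I`. -/
theorem eq_neg_sum_greenMatrix (hA : ∀ m, conj (A m) = A (-m)) (hs : Summable fun m => ‖A m‖)
    (V : EllInftyReal) (I : Finset ℤ) {z : ℂ} (hz : z.im ≠ 0) (u : EllTwo)
    (hu : ∀ n ∈ I, longRangeOp A V u n - z * u n = 0) (m : I) :
    u m = -∑ k : I, greenMatrix A V I z m k *
      ∑' l : ℤ, A (k - l) * (if l ∈ I then 0 else u l) := by
  set f : I → ℂ := fun k => ∑' l : ℤ, A (k - l) * (if l ∈ I then 0 else u l) with hf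
  set x : I → ℂ := fun k => u k
  set L := restrictedMatrix A V I - z • (1 : Matrix I I ℂ)
  -- Each row of the equation is split at `I`: the sites inside form the matrix, the sites outside a
  -- source term.
  have key : L.mulVec x = -f := by
    funext k
    have h1 := hasSum_longRangeOp hs V u k
    have h2 : HasSum (fun l : ℤ => A (k - l) * (if l ∈ I then u l else 0))
        (∑ l : I, A (k - l) * u l) := by
      rw [Finset.sum_coe_sort I fun l => A (k - l) * u l]
      have : HasSum (fun l : ℤ => A (k - l) * (if l ∈ I then u l else 0))
          (∑ l ∈ I, A (k - l) * (if l ∈ I then u l else 0)) :=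
        hasSum_sum_of_ne_finset_zero fun l hl => by simp [hl]
      rwa [Finset.sum_congr rfl (fun l hl => by rw [if_pos hl])] at this
    have h3 := h1.sub h2
    have h4 : (fun l : ℤ => A (k - l) * u l - A (k - l) * (if l ∈ I then u l else 0))
        = fun l : ℤ => A (k - l) * (if l ∈ I then 0 else u l) := by
      funext l
      by_cases hl : l ∈ I <;> simp [hl]
    rw [h4] at h3
    have h5 := h3.tsum_eq
    change f k = _ at h5
    have h6 := hu k k.2
    have h7 : L.mulVec x k = (∑ l : I, A (k - l) * u l) + (V k : ℂ) * u k - z * u k := by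
      simp only [L, x, Matrix.sub_mulVec, Matrix.smul_mulVec, Matrix.one_mulVec, Pi.sub_apply,
        Pi.smul_apply, smul_eq_mul]
      simp [Matrix.mulVec, dotProduct, restrictedMatrix, add_mul, Finset.sum_add_distrib]
    rw [Pi.neg_apply, h5, h7]
    linear_combination h6
  have h1 : (greenMatrix A V I z).mulVec (L.mulVec x) = x := by
    rw [Matrix.mulVec_mulVec, greenMatrix, Matrix.nonsing_inv_mul _
      ((isHermitian_restrictedMatrix hA V I).isUnit_det_sub_smul hz), Matrix.one_mulVec]
  rw [key, Matrix.mulVec_neg] at h1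
  exact (congrFun h1 m).symm

end Green

/-! ### Decay of solutions behind a good interval -/

open Classical in
/-- The indicator sequence of a set of integers. -/
noncomputable def maskSeq (s : Set ℤ) : EllInftyReal :=
  ⟨fun n => if n ∈ s then 1 else 0, memℓp_infty ⟨1, by
    rintro _ ⟨n, rfl⟩
    dsimp only
    split_ifs <;> simp⟩⟩

open Classical in
theorem mask_apply (s : Set ℤ) (u : EllTwo) (n : ℤ) :
    potentialOp (maskSeq s) u n = if n ∈ s then u n else 0 := by
  change (((if n ∈ s then 1 else 0 : ℝ)) : ℂ) * u n = _
  split_ifs <;> simp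

theorem norm_apply_le (u : EllTwo) (n : ℤ) : ‖u n‖ ≤ ‖u‖ :=
  lp.norm_apply_le_norm (by simp) u n

/-- The weighted sum `∑_n e^{-c|n-k|} |u_n|`. -/
noncomputable def localSum (c : ℝ) (k : ℤ) (u : EllTwo) : ℝ :=
  ∑' n : ℤ, Real.exp (-c * |(n : ℝ) - k|) * ‖u n‖

theorem summable_localSum {c : ℝ} (hc : 0 < c) (k : ℤ) (u : EllTwo) :
    Summable fun n : ℤ => Real.exp (-c * |(n : ℝ) - k|) * ‖u n‖ :=
  Summable.of_nonneg_of_le (fun _ => by positivity)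
    (fun n => mul_le_mul_of_nonneg_left (norm_apply_le u n) (Real.exp_pos _).le)
    ((summable_exp_neg_abs_sub hc k).mul_right ‖u‖)

section

variable {A : ℤ → ℂ} {C₁ c₁ : ℝ}

/-- Cut `u` into `w` on `P` and `v` off `P`. Since `φ` and `v` vanish on `P`, pairing `(H - z)w`
with `w` leaves only `-⟨w, Hv⟩`, while its imaginary part is `-Im z ‖w‖²`. By `hP` each hop between
`P` and its complement passes over `k`, so the kernel bound factorises and gives one `localSum` for
each side. -/
theorem im_mul_norm_sq_mask_le (hAs : ∀ m, conj (A m) = A (-m)) (hC₁ : 0 ≤ C₁) (hc₁ : 0 < c₁)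
    (hA : ∀ m : ℤ, ‖A m‖ ≤ C₁ * Real.exp (-c₁ * |(m : ℝ)|)) (V : EllInftyReal) {z : ℂ}
    (hz : 0 < z.im) {u φ : EllTwo} (hu : longRangeOp A V u - z • u = φ) {P : Set ℤ} {k : ℤ}
    (hP : ∀ n ∈ P, ∀ l ∉ P, |(n : ℝ) - k| + |(l : ℝ) - k| ≤ |(n : ℝ) - l|)
    (hφ : ∀ n ∈ P, φ n = 0) :
    z.im * ‖potentialOp (maskSeq P) u‖ ^ 2 ≤ C₁ * localSum c₁ k u ^ 2 := by
  classical
  set H := longRangeOp A V with hH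
  have hHs : IsSelfAdjoint H := isSelfAdjoint_longRangeOp hAs V
  set w := potentialOp (maskSeq P) u with hw
  set v := u - w with hv
  set S := localSum c₁ k u with hS
  have hwn : ∀ n, w n = if n ∈ P then u n else 0 := mask_apply P u
  have hvn : ∀ n, v n = if n ∈ P then 0 else u n := fun n => by
    change u n - w n = _
    rw [hwn]; split_ifs <;> simp
  have hzero : ∀ x : EllTwo, (∀ n ∈ P, x n = 0) → ⟪w, x⟫_ℂ = 0 := fun x hx => by
    rw [lp.inner_eq_tsum]
    refine (tsum_congr fun n => ?_).trans tsum_zero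
    by_cases hn : n ∈ P
    · rw [hx n hn, inner_zero_right]
    · rw [hwn, if_neg hn, inner_zero_left]
  have h1 : H w - z • w = φ - H v + z • v := by
    rw [← hu, hv, map_sub]; module
  have h2 : ⟪w, H w - z • w⟫_ℂ = -⟪w, H v⟫_ℂ := by
    rw [h1, inner_add_right, inner_sub_right, inner_smul_right, hzero φ hφ,
      hzero v (fun n hn => by rw [hvn, if_pos hn])]
    ring
  have hSn : 0 ≤ S := tsum_nonneg fun _ => by positivity
  have h3 : ∀ n ∈ P, ‖H v n‖ ≤ C₁ * Real.exp (-c₁ * |(n : ℝ) - k|) * S := fun n hn => by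
    have h := hasSum_longRangeOp (summable_norm_hopping hc₁ hA) V v n
    rw [hvn n, if_pos hn, mul_zero, sub_zero] at h
    refine h.norm_le_of_bounded ((summable_localSum hc₁ k u).hasSum.mul_left _) fun l => ?_
    rw [hvn]
    split_ifs with hl
    · rw [mul_zero, norm_zero]; positivity
    rw [norm_mul]
    calc ‖A (n - l)‖ * ‖u l‖
        ≤ (C₁ * (Real.exp (-c₁ * |(n : ℝ) - k|) * Real.exp (-c₁ * |(l : ℝ) - k|))) * ‖u l‖ := by
          gcongr
          refine (hA _).trans ?_
          rw [← Real.exp_add]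
          gcongr
          have := hP n hn l hl
          push_cast
          nlinarith
      _ = _ := by ring
  have h4 : ‖⟪w, H v⟫_ℂ‖ ≤ C₁ * S * S := by
    rw [lp.inner_eq_tsum]
    refine tsum_of_norm_bounded ((summable_localSum hc₁ k u).hasSum.mul_left (C₁ * S)) fun n => ?_
    by_cases hn : n ∈ P
    · rw [hwn, if_pos hn]
      refine (norm_inner_le_norm _ _).trans ?_
      refine (mul_le_mul_of_nonneg_left (h3 n hn) (norm_nonneg _)).trans (le_of_eq ?_)
      ring
    · rw [hwn, if_neg hn, inner_zero_left, norm_zero]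
      positivity
  have h5 := im_inner_sub_smul hHs w z
  calc z.im * ‖w‖ ^ 2 = |(⟪w, H w - z • w⟫_ℂ).im| := by
        rw [h5, abs_mul, abs_neg, abs_of_pos hz, abs_of_nonneg (by positivity)]
    _ ≤ ‖⟪w, H w - z • w⟫_ℂ‖ := Complex.abs_im_le_norm _
    _ = ‖⟪w, H v⟫_ℂ‖ := by rw [h2, norm_neg]
    _ ≤ _ := h4.trans_eq (by ring)

/-- In the central part of an interval with decaying Green's function, solutions are small. -/
theorem norm_apply_le_of_greenDecay (hAs : ∀ m, conj (A m) = A (-m)) (hC₁ : 0 ≤ C₁)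
    {c₂ : ℝ} (hc₂ : 0 < c₂) (hc₂₁ : c₂ ≤ c₁)
    (hA : ∀ m : ℤ, ‖A m‖ ≤ C₁ * Real.exp (-c₁ * |(m : ℝ)|)) (V : EllInftyReal) {z : ℂ}
    (hz : 0 < z.im) (hz1 : z.im ≤ 1) {u φ : EllTwo} (hu : longRangeOp A V u - z • u = φ)
    {I : Finset ℤ} {k₀ : ℤ} (hI : ∀ l ∉ I, (I.card : ℝ) / 2 ≤ |(l : ℝ) - k₀|)
    (hφ : ∀ n ∈ I, φ n = 0) (hG : GreenDecay A V I z c₂) (m : I)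
    (hm : |((m : ℤ) : ℝ) - k₀| ≤ (I.card : ℝ) / 5) :
    ‖u m‖ ≤ C₁ * expSum (c₁ / 2) * ‖u‖ * (I.card / z.im) * Real.exp (-(c₂ / 8) * I.card) := by
  have hc₁ : 0 < c₁ := hc₂.trans_le hc₂₁
  have hun : ∀ n ∈ I, longRangeOp A V u n - z * u n = 0 := fun n hn => by
    have h := congrArg (fun x : EllTwo => x n) hu
    exact h.trans (hφ n hn)
  rw [eq_neg_sum_greenMatrix hAs (summable_norm_hopping hc₁ hA) V I hz.ne' u hun m, norm_neg]
  set D := C₁ * expSum (c₁ / 2) * ‖u‖ with hD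
  have hD0 : 0 ≤ D := by have := expSum_nonneg (c₁ / 2); positivity
  have hv : ∀ l : ℤ, ‖(if l ∈ I then 0 else u l : ℂ)‖ ≤ ‖u‖ := fun l => by
    split_ifs
    · simp
    · exact norm_apply_le u l
  have hf : ∀ (k : ℤ) (d : ℝ), (∀ l ∉ I, d ≤ |(k : ℝ) - l|) →
      ‖∑' l : ℤ, A (k - l) * (if l ∈ I then 0 else u l)‖ ≤ D * Real.exp (-(c₁ / 2) * d) :=
    fun k d hd => norm_hopping_mul_le hC₁ hc₁ hA hv fun l hl => hd l fun h => hl (if_pos h)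
  have hterm : ∀ k : I, ‖greenMatrix A V I z m k *
      ∑' l : ℤ, A (k - l) * (if l ∈ I then 0 else u l)‖
        ≤ D * (1 / z.im) * Real.exp (-(c₂ / 8) * I.card) := fun k => by
    have hcard : (0 : ℝ) ≤ I.card := by positivity
    have hz2 : 1 ≤ 1 / z.im := by rwa [le_div_iff₀ hz, one_mul]
    rw [norm_mul]
    -- If `k` is far from `m`, the Green's function decays and the source need only be bounded. If
    -- `k` is near `m`, only `1 / Im z` is known, but `k` is still at distance `1/2 - 1/5 - 1/20 =
    -- 1/4` of `|I|` from the complement of `I`, so the source is small.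
    rcases lt_or_ge ((I.card : ℝ) / 20) |((m : ℤ) : ℝ) - ((k : ℤ) : ℝ)| with h | h
    · have h1 := (hG m k h).le
      have h2 := hf k 0 (fun _ _ => abs_nonneg _)
      rw [mul_zero, Real.exp_zero, mul_one] at h2
      calc _ ≤ Real.exp (-c₂ * I.card) * D := by gcongr
        _ ≤ Real.exp (-(c₂ / 8) * I.card) * (D * (1 / z.im)) := by
          gcongr
          · linarith
          · exact le_mul_of_one_le_right hD0 hz2
        _ = _ := by ring
    · have h1 := (isHermitian_restrictedMatrix hAs V I).norm_inv_sub_smul_apply_le hz.ne' m k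
      rw [abs_of_pos hz] at h1
      have h2 := hf k (I.card / 4) (fun l hl => by
        have h3 := hI l hl
        have h4 : |(l : ℝ) - k₀| ≤ |((k : ℤ) : ℝ) - l| + |((m : ℤ) : ℝ) - ((k : ℤ) : ℝ)|
            + |((m : ℤ) : ℝ) - k₀| := by
          rw [abs_sub_comm ((k : ℤ) : ℝ), abs_sub_comm ((m : ℤ) : ℝ) k]
          exact (abs_sub_le _ ((m : ℤ) : ℝ) _).trans
            (add_le_add_left (abs_sub_le _ ((k : ℤ) : ℝ) _) _)
        linarith)
      calc _ ≤ (1 / z.im) * (D * Real.exp (-(c₁ / 2) * (I.card / 4))) := by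
            gcongr
            exact h1
        _ ≤ (1 / z.im) * (D * Real.exp (-(c₂ / 8) * I.card)) := by
          have h3 : -(c₁ / 2) * ((I.card : ℝ) / 4) ≤ -(c₂ / 8) * I.card := by
            linarith [mul_le_mul_of_nonneg_right hc₂₁ hcard]
          gcongr
        _ = _ := by ring
  refine (norm_sum_le_of_le _ fun k _ => hterm k).trans (le_of_eq ?_)
  simp only [Finset.sum_const, Finset.card_univ, Fintype.card_coe, nsmul_eq_mul]
  ring

/-- In the core `|n - k₀| ≤ |I|/5` the solution is small; outside it half of the weight gives
`e^{-(c₁/2)|I|/5}`, whence the rate `c₂/10`. The factor `|I| / Im z` is at least 1 and may be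
inserted freely. -/
theorem localSum_le_of_greenDecay (hAs : ∀ m, conj (A m) = A (-m)) (hC₁ : 0 ≤ C₁)
    {c₂ : ℝ} (hc₂ : 0 < c₂) (hc₂₁ : c₂ ≤ c₁)
    (hA : ∀ m : ℤ, ‖A m‖ ≤ C₁ * Real.exp (-c₁ * |(m : ℝ)|)) (V : EllInftyReal) {z : ℂ}
    (hz : 0 < z.im) (hz1 : z.im ≤ 1) {u φ : EllTwo} (hu : longRangeOp A V u - z • u = φ)
    {I : Finset ℤ} (hIne : I.Nonempty) {k₀ : ℤ}
    (hI : ∀ l ∉ I, (I.card : ℝ) / 2 ≤ |(l : ℝ) - k₀|)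
    (hφ : ∀ n ∈ I, φ n = 0) (hG : GreenDecay A V I z c₂) :
    localSum c₁ k₀ u ≤ expSum (c₁ / 2) * (C₁ * expSum (c₁ / 2) + 1) * ‖u‖ *
      (I.card / z.im) * Real.exp (-(c₂ / 10) * I.card) := by
  have hc₁ : 0 < c₁ := hc₂.trans_le hc₂₁
  have hcard : (1 : ℝ) ≤ I.card := by exact_mod_cast hIne.card_pos
  have hR : 1 ≤ (I.card : ℝ) / z.im := by rw [le_div_iff₀ hz]; linarith
  have hE := expSum_nonneg (c₁ / 2)
  have h1 := ((summable_exp_neg_abs_sub (half_pos hc₁) k₀).hasSum).mul_right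
    ((C₁ * expSum (c₁ / 2) + 1) * ‖u‖ * (I.card / z.im) * Real.exp (-(c₂ / 10) * I.card))
  rw [tsum_exp_neg_abs_sub] at h1
  refine (hasSum_le (fun n => ?_) (summable_localSum hc₁ k₀ u).hasSum h1).trans_eq (by ring)
  rcases le_or_gt |(n : ℝ) - k₀| ((I.card : ℝ) / 5) with h | h
  · have hn : n ∈ I := by
      by_contra hn
      linarith [hI n hn]
    have h2 := norm_apply_le_of_greenDecay hAs hC₁ hc₂ hc₂₁ hA V hz hz1 hu hI hφ hG ⟨n, hn⟩ h
    have h3 : C₁ * expSum (c₁ / 2) * ‖u‖ * (I.card / z.im) * Real.exp (-(c₂ / 8) * I.card)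
        ≤ (C₁ * expSum (c₁ / 2) + 1) * ‖u‖ * (I.card / z.im) * Real.exp (-(c₂ / 10) * I.card) := by
      gcongr
      · linarith
      · linarith
    refine mul_le_mul ?_ (h2.trans h3) (norm_nonneg _) (Real.exp_pos _).le
    rw [Real.exp_le_exp]
    nlinarith [abs_nonneg ((n : ℝ) - k₀)]
  · have h2 : Real.exp (-c₁ * |(n : ℝ) - k₀|)
        ≤ Real.exp (-(c₁ / 2) * |(n : ℝ) - k₀|) * Real.exp (-(c₂ / 10) * I.card) := by
      rw [← Real.exp_add, Real.exp_le_exp]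
      nlinarith
    have h3 : ‖u‖ ≤ (C₁ * expSum (c₁ / 2) + 1) * ‖u‖ * (I.card / z.im) := by
      have h4 : 1 ≤ (C₁ * expSum (c₁ / 2) + 1) * (I.card / z.im) :=
        one_le_mul_of_one_le_of_one_le (by nlinarith [mul_nonneg hC₁ hE]) hR
      nlinarith [norm_nonneg u]
    calc _ ≤ (Real.exp (-(c₁ / 2) * |(n : ℝ) - k₀|) * Real.exp (-(c₂ / 10) * I.card)) *
          ((C₁ * expSum (c₁ / 2) + 1) * ‖u‖ * (I.card / z.im)) := by
          gcongr
          exact (norm_apply_le u n).trans h3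
      _ = _ := by ring

theorem sq_mul_exp_neg_le {c x : ℝ} (hc : 0 < c) (hx : 0 ≤ x) :
    x ^ 2 * Real.exp (-(c / 5) * x) ≤ 200 / c ^ 2 * Real.exp (-(c / 10) * x) := by
  have h1 := Real.quadratic_le_exp_of_nonneg (x := c / 10 * x) (by positivity)
  have h2 : x ^ 2 ≤ 200 / c ^ 2 * Real.exp (c / 10 * x) := by
    rw [div_mul_eq_mul_div, le_div_iff₀ (by positivity)]
    nlinarith [mul_nonneg hc.le hx]
  calc x ^ 2 * Real.exp (-(c / 5) * x)
      ≤ 200 / c ^ 2 * Real.exp (c / 10 * x) * Real.exp (-(c / 5) * x) := by gcongr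
    _ = _ := by rw [mul_assoc, ← Real.exp_add]; ring_nf

/-- Decay of solutions behind an interval with decaying Green's function. -/
theorem norm_sq_apply_le_of_greenDecay (hAs : ∀ m, conj (A m) = A (-m)) (hC₁ : 0 ≤ C₁)
    {c₂ : ℝ} (hc₂ : 0 < c₂) (hc₂₁ : c₂ ≤ c₁)
    (hA : ∀ m : ℤ, ‖A m‖ ≤ C₁ * Real.exp (-c₁ * |(m : ℝ)|)) (V : EllInftyReal) {z : ℂ}
    (hz : 0 < z.im) (hz1 : z.im ≤ 1) {u φ : EllTwo} (hu : longRangeOp A V u - z • u = φ)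
    {I : Finset ℤ} (hIne : I.Nonempty) {k₀ : ℤ}
    (hI : ∀ l ∉ I, (I.card : ℝ) / 2 ≤ |(l : ℝ) - k₀|)
    (hφ : ∀ n ∈ I, φ n = 0) (hG : GreenDecay A V I z c₂) {P : Set ℤ}
    (hP : ∀ n ∈ P, ∀ l ∉ P, |(n : ℝ) - k₀| + |(l : ℝ) - k₀| ≤ |(n : ℝ) - l|)
    (hφP : ∀ n ∈ P, φ n = 0) {N : ℤ} (hN : N ∈ P) :
    ‖u N‖ ^ 2 ≤ C₁ * (expSum (c₁ / 2) * (C₁ * expSum (c₁ / 2) + 1)) ^ 2 * (200 / c₂ ^ 2) *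
      ‖φ‖ ^ 2 * (z.im⁻¹) ^ 5 * Real.exp (-(c₂ / 10) * I.card) := by
  have hc₁ : 0 < c₁ := hc₂.trans_le hc₂₁
  have h1 := im_mul_norm_sq_mask_le hAs hC₁ hc₁ hA V hz hu hP hφP
  have h2 := localSum_le_of_greenDecay hAs hC₁ hc₂ hc₂₁ hA V hz hz1 hu hIne hI hφ hG
  have h3 : 0 ≤ localSum c₁ k₀ u := tsum_nonneg fun _ => by positivity
  have h4 : ‖u N‖ ≤ ‖potentialOp (maskSeq P) u‖ := by
    have := norm_apply_le (potentialOp (maskSeq P) u) N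
    rwa [mask_apply, if_pos hN] at this
  have h5 := norm_le_of_apply_sub_smul (isSelfAdjoint_longRangeOp hAs V) hz hu
  have h6 := sq_mul_exp_neg_le hc₂ (Nat.cast_nonneg (α := ℝ) I.card)
  set Q := expSum (c₁ / 2) * (C₁ * expSum (c₁ / 2) + 1) with hQ
  have hQ0 : 0 ≤ Q := by have := expSum_nonneg (c₁ / 2); positivity
  have h7 : localSum c₁ k₀ u ≤ Q * (‖φ‖ / z.im) * (I.card / z.im) *
      Real.exp (-(c₂ / 10) * I.card) := h2.trans (by gcongr)
  -- The fifth power of `1 / Im z`: one from the flux inequality, four from squaring `(‖φ‖ / Im z)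
  -- (|I| / Im z)`.
  calc ‖u N‖ ^ 2 ≤ ‖potentialOp (maskSeq P) u‖ ^ 2 := by gcongr
    _ ≤ C₁ * localSum c₁ k₀ u ^ 2 / z.im := by rw [le_div_iff₀ hz, mul_comm]; exact h1
    _ ≤ C₁ * (Q * (‖φ‖ / z.im) * (I.card / z.im) * Real.exp (-(c₂ / 10) * I.card)) ^ 2 / z.im := by
      gcongr
    _ = C₁ * Q ^ 2 * ‖φ‖ ^ 2 * (z.im⁻¹) ^ 5 *
        ((I.card : ℝ) ^ 2 * Real.exp (-(c₂ / 5) * I.card)) := by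
      have h8 : Real.exp (-(c₂ / 5) * I.card) = Real.exp (-(c₂ / 10) * I.card) ^ 2 := by
        rw [← Real.exp_nat_mul]; push_cast; ring_nf
      rw [h8]
      field_simp
    _ ≤ C₁ * Q ^ 2 * ‖φ‖ ^ 2 * (z.im⁻¹) ^ 5 *
        (200 / c₂ ^ 2 * Real.exp (-(c₂ / 10) * I.card)) := by gcongr
    _ = _ := by ring

end

theorem exists_center_Icc {a b : ℤ} (hab : a ≤ b) :
    ∃ k₀ ∈ Finset.Icc a b, ∀ l ∉ Finset.Icc a b,
      ((Finset.Icc a b).card : ℝ) / 2 ≤ |(l : ℝ) - k₀| := by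
  have hcard : ((Finset.Icc a b).card : ℤ) = b + 1 - a := by
    rw [Int.card_Icc, Int.toNat_of_nonneg (by linarith)]
  -- With the rounded-down half, `a - 1` is at distance `⌊|I|/2⌋ + 1` and `b + 1` at distance
  -- `⌈|I|/2⌉`; both suffice.
  refine ⟨a + (b + 1 - a) / 2, Finset.mem_Icc.2 ⟨by omega, by omega⟩, fun l hl => ?_⟩
  have h1 : ((Finset.Icc a b).card : ℤ) ≤ 2 * |l - (a + (b + 1 - a) / 2)| := by
    rw [hcard]
    rw [Finset.mem_Icc] at hl
    rcases abs_cases (l - (a + (b + 1 - a) / 2)) with h | h <;> omega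
  have h2 : ((Finset.Icc a b).card : ℝ) ≤ 2 * |(l : ℝ) - (a + (b + 1 - a) / 2 : ℤ)| := by
    exact_mod_cast h1
  linarith

section

variable {A : ℤ → ℂ} {C₁ c₁ : ℝ}

/-- Decay at `N` of solutions, given an interval between the origin and `N` with decaying Green's
function. -/
theorem norm_sq_apply_le_of_isIntervalTowards (hAs : ∀ m, conj (A m) = A (-m)) (hC₁ : 0 ≤ C₁)
    {c₂ : ℝ} (hc₂ : 0 < c₂) (hc₂₁ : c₂ ≤ c₁)
    (hA : ∀ m : ℤ, ‖A m‖ ≤ C₁ * Real.exp (-c₁ * |(m : ℝ)|)) (V : EllInftyReal) {z : ℂ}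
    (hz : 0 < z.im) (hz1 : z.im ≤ 1) {u φ : EllTwo} (hu : longRangeOp A V u - z • u = φ)
    {r : ℝ} (hr : ∀ n : ℤ, r < |(n : ℝ)| → φ n = 0)
    {N : ℤ} (hN0 : N ≠ 0) (hN : 4 * r < |(N : ℝ)|) {I : Finset ℤ} (hIne : I.Nonempty)
    (hI : IsIntervalTowards N I) (hG : GreenDecay A V I z c₂) :
    ‖u N‖ ^ 2 ≤ C₁ * (expSum (c₁ / 2) * (C₁ * expSum (c₁ / 2) + 1)) ^ 2 * (200 / c₂ ^ 2) *
      ‖φ‖ ^ 2 * (z.im⁻¹) ^ 5 * Real.exp (-(c₂ / 10) * I.card) := by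
  obtain ⟨⟨a, b, rfl⟩, hpos, hneg⟩ := hI
  obtain ⟨k₀, hk₀, hfar⟩ := exists_center_Icc (Finset.nonempty_Icc.1 hIne)
  -- `P` is the open half-line beyond `k₀`, away from the origin. It contains `N` since `|k₀| ≤
  -- |N|/2`, and misses the support of `φ` since `|k₀| ≥ |N|/4 > r`.
  rcases lt_or_gt_of_ne hN0 with h0 | h0
  · have h0' : (N : ℝ) < 0 := by exact_mod_cast h0
    have hneg := hneg h0
    rw [abs_of_neg h0'] at hneg hN
    refine norm_sq_apply_le_of_greenDecay hAs hC₁ hc₂ hc₂₁ hA V hz hz1 hu hIne hfar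
      (fun n hn => hr n ?_) hG (P := {n | n < k₀}) (fun n hn l hl => ?_) (fun n hn => hr n ?_) ?_
    · have := (hneg n hn).2
      rw [abs_of_neg (by linarith)]; linarith
    · have h1 : (n : ℝ) < k₀ := by exact_mod_cast hn
      have h2 : (k₀ : ℝ) ≤ l := by exact_mod_cast not_lt.1 hl
      rw [abs_of_nonpos (by linarith), abs_of_nonneg (by linarith), abs_of_nonpos (by linarith)]
      linarith
    · have h1 : (n : ℝ) < k₀ := by exact_mod_cast hn
      have := (hneg k₀ hk₀).2
      rw [abs_of_neg (by linarith)]; linarith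
    · have := (hneg k₀ hk₀).1
      have h1 : (N : ℝ) < k₀ := by linarith
      exact_mod_cast h1
  · have h0' : (0 : ℝ) < N := by exact_mod_cast h0
    have hpos := hpos h0
    rw [abs_of_pos h0'] at hpos hN
    refine norm_sq_apply_le_of_greenDecay hAs hC₁ hc₂ hc₂₁ hA V hz hz1 hu hIne hfar
      (fun n hn => hr n ?_) hG (P := {n | k₀ < n}) (fun n hn l hl => ?_) (fun n hn => hr n ?_) ?_
    · have := (hpos n hn).1
      rw [abs_of_pos (by linarith)]; linarith
    · have h1 : (k₀ : ℝ) < n := by exact_mod_cast hn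
      have h2 : (l : ℝ) ≤ k₀ := by exact_mod_cast not_lt.1 hl
      rw [abs_of_nonneg (by linarith), abs_of_nonpos (by linarith), abs_of_nonneg (by linarith)]
      linarith
    · have h1 : (k₀ : ℝ) < n := by exact_mod_cast hn
      have := (hpos k₀ hk₀).1
      rw [abs_of_pos (by linarith)]; linarith
    · have := (hpos k₀ hk₀).2
      have h1 : (k₀ : ℝ) < N := by linarith
      exact_mod_cast h1

end

/-! ### Combes-Thomas estimate for energies off the spectrum -/

section CombesThomas

/-- Since `e^{ax} - 1 ≤ a x e^{ax}`, the sum is of order `a`, uniformly over the hopping sequences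
with these constants. The threshold `1/2` is half of the gap between the spectrum and `|E| ≥ K`. -/
theorem exists_combesThomas_rate {C₁ c₁ : ℝ} (hC₁ : 0 ≤ C₁) (hc₁ : 0 < c₁) :
    ∃ a : ℝ, 0 < a ∧ ∀ A : ℤ → ℂ, (∀ m : ℤ, ‖A m‖ ≤ C₁ * Real.exp (-c₁ * |(m : ℝ)|)) →
      ∃ s ≤ (1 / 2 : ℝ), HasSum (fun m : ℤ => ‖A m‖ * (Real.exp (a * |(m : ℝ)|) - 1)) s := by
  set Q := C₁ * (4 / c₁) * expSum (c₁ / 2) with hQ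
  have hQ0 : 0 ≤ Q := by have := expSum_nonneg (c₁ / 2); positivity
  set a := min (c₁ / 4) (1 / (2 * (Q + 1))) with ha
  have ha0 : 0 < a := lt_min (by positivity) (by positivity)
  refine ⟨a, ha0, fun A hA => ?_⟩
  have hle : ∀ m : ℤ, ‖A m‖ * (Real.exp (a * |(m : ℝ)|) - 1)
      ≤ (a * (C₁ * (4 / c₁))) * Real.exp (-(c₁ / 2) * |(m : ℝ)|) := fun m => by
    set x := |(m : ℝ)| with hx
    have hx0 : 0 ≤ x := abs_nonneg _
    have h1 : Real.exp (a * x) - 1 ≤ a * x * Real.exp (a * x) := by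
      have h := mul_le_mul_of_nonneg_right (Real.add_one_le_exp (-(a * x))) (Real.exp_pos (a * x)).le
      rw [← Real.exp_add, neg_add_cancel, Real.exp_zero] at h
      linarith
    have h2 : x ≤ 4 / c₁ * Real.exp (c₁ / 4 * x) := by
      have h := Real.add_one_le_exp (c₁ / 4 * x)
      rw [div_mul_eq_mul_div, le_div_iff₀ hc₁]
      linarith
    have h3 : Real.exp (a * x) ≤ Real.exp (c₁ / 4 * x) := by
      gcongr
      exact min_le_left _ _
    have h4 : 0 ≤ Real.exp (a * x) - 1 := by
      have := Real.one_le_exp (mul_nonneg ha0.le hx0); linarith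
    calc ‖A m‖ * (Real.exp (a * x) - 1)
        ≤ (C₁ * Real.exp (-c₁ * x)) *
          (a * (4 / c₁ * Real.exp (c₁ / 4 * x)) * Real.exp (c₁ / 4 * x)) := by
          gcongr
          · exact hA m
          · exact h1.trans (by gcongr)
      _ = (a * (C₁ * (4 / c₁))) *
          (Real.exp (-c₁ * x) * Real.exp (c₁ / 4 * x) * Real.exp (c₁ / 4 * x)) := by ring
      _ = _ := by rw [← Real.exp_add, ← Real.exp_add]; ring_nf
  have h1 := ((summable_exp_neg_abs (half_pos hc₁)).hasSum).mul_left (a * (C₁ * (4 / c₁)))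
  have h2 : Summable fun m : ℤ => ‖A m‖ * (Real.exp (a * |(m : ℝ)|) - 1) := by
    refine Summable.of_nonneg_of_le (fun m => mul_nonneg (norm_nonneg _) ?_) hle h1.summable
    have := Real.one_le_exp (mul_nonneg ha0.le (abs_nonneg (m : ℝ))); linarith
  refine ⟨_, (hasSum_le hle h2.hasSum h1).trans ?_, h2.hasSum⟩
  change a * (C₁ * (4 / c₁)) * expSum (c₁ / 2) ≤ _
  have h3 : a * (2 * (Q + 1)) ≤ 1 := by
    rw [← le_div_iff₀ (by positivity)]; exact min_le_right _ _
  have h4 : a * (C₁ * (4 / c₁)) * expSum (c₁ / 2) = a * Q := by rw [hQ]; ring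
  rw [h4]
  linarith

/-- The truncated exponential weight `e^{a min(|n|, R)}`. -/
noncomputable def expWeight (a R : ℝ) (ha : 0 ≤ a) : EllInftyReal :=
  ⟨fun n : ℤ => Real.exp (a * min |(n : ℝ)| R), memℓp_infty ⟨Real.exp (a * R), by
    rintro _ ⟨n, rfl⟩
    dsimp only
    rw [Real.norm_eq_abs, Real.abs_exp]
    gcongr
    exact min_le_right _ _⟩⟩

theorem expWeight_apply (a R : ℝ) (ha : 0 ≤ a) (n : ℤ) :
    expWeight a R ha n = Real.exp (a * min |(n : ℝ)| R) := rfl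

/-- The truncated distance is 1-Lipschitz, so the bound does not involve `R`. -/
theorem abs_expWeight_sub_le (a R : ℝ) (ha : 0 ≤ a) (n k : ℤ) :
    |expWeight a R ha n - expWeight a R ha k|
      ≤ (Real.exp (a * |(n : ℝ) - k|) - 1) * expWeight a R ha k := by
  have key : ∀ n k : ℤ, expWeight a R ha n
      ≤ Real.exp (a * |(n : ℝ) - k|) * expWeight a R ha k := fun n k => by
    rw [expWeight_apply, expWeight_apply, ← Real.exp_add, ← mul_add]
    gcongr
    have h1 : |(n : ℝ)| ≤ |(n : ℝ) - k| + |(k : ℝ)| := by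
      simpa using abs_add_le ((n : ℝ) - k) k
    rcases le_total |(k : ℝ)| R with h | h
    · rw [min_eq_left h]; exact (min_le_left _ _).trans h1
    · rw [min_eq_right h]; exact (min_le_right _ _).trans (by linarith [abs_nonneg ((n : ℝ) - k)])
  have h1 := key n k
  have h2 := key k n
  rw [abs_sub_comm] at h2
  have hk : 0 < expWeight a R ha k := Real.exp_pos _
  have hn : 0 < expWeight a R ha n := Real.exp_pos _
  have he : 1 ≤ Real.exp (a * |(n : ℝ) - k|) := Real.one_le_exp (by positivity)
  rw [abs_le]
  constructor
  -- With `e` the exponential, this reduces to `2 - e ≤ 1/e`, which is `(e - 1)² ≥ 0`.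
  · nlinarith [sq_nonneg (Real.exp (a * |(n : ℝ) - k|) - 1)]
  · linarith

theorem EllTwo.norm_le_of_forall_norm_le {x y : EllTwo} {C : ℝ} (hC : 0 ≤ C)
    (h : ∀ n, ‖x n‖ ≤ C * ‖y n‖) : ‖x‖ ≤ C * ‖y‖ := by
  rw [← sq_le_sq₀ (norm_nonneg _) (by positivity), mul_pow, EllTwo.norm_sq, EllTwo.norm_sq,
    ← tsum_mul_left]
  refine Summable.tsum_le_tsum (fun n => ?_) x.summable_sq (y.summable_sq.mul_left _)
  rw [← mul_pow]
  gcongr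
  exact h n

theorem norm_commutator_shiftOp_le (a R : ℝ) (ha : 0 ≤ a) (m : ℤ) (u : EllTwo) :
    ‖potentialOp (expWeight a R ha) (shiftOp m u) - shiftOp m (potentialOp (expWeight a R ha) u)‖
      ≤ (Real.exp (a * |(m : ℝ)|) - 1) * ‖potentialOp (expWeight a R ha) u‖ := by
  set W := expWeight a R ha
  have h0 : 0 ≤ Real.exp (a * |(m : ℝ)|) - 1 := by
    have := Real.one_le_exp (mul_nonneg ha (abs_nonneg (m : ℝ))); linarith
  have h1 : ‖shiftOp m (potentialOp W u)‖ ≤ ‖potentialOp W u‖ :=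
    ((shiftOp m).le_of_opNorm_le (norm_shiftOp_le m) _).trans_eq (one_mul _)
  refine (EllTwo.norm_le_of_forall_norm_le h0 fun n => ?_).trans
    (mul_le_mul_of_nonneg_left h1 h0)
  have h2 := abs_expWeight_sub_le a R ha n (n - m)
  have h3 : (n : ℝ) - ((n - m : ℤ) : ℝ) = m := by push_cast; ring
  rw [h3] at h2
  change ‖(W n : ℂ) * u (n - m) - (W (n - m) : ℂ) * u (n - m)‖ ≤ _ * ‖(W (n - m) : ℂ) * u (n - m)‖
  rw [← sub_mul, norm_mul, norm_mul, ← mul_assoc, ← Complex.ofReal_sub, Complex.norm_real,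
    Complex.norm_real, Real.norm_eq_abs, Real.norm_eq_abs]
  gcongr
  exact h2.trans (mul_le_mul_of_nonneg_left (le_abs_self _) h0)

theorem norm_commutator_le_of_hasSum {E : Type*} [NormedAddCommGroup E] [NormedSpace ℂ E]
    {S : ℤ → E →L[ℂ] E} {T : E →L[ℂ] E} {A : ℤ → ℂ} (hT : HasSum (fun m => A m • S m) T)
    (W : E →L[ℂ] E) (u : E) {b : ℤ → ℝ} (hb : ∀ m, ‖W (S m u) - S m (W u)‖ ≤ b m) {s : ℝ}
    (hs : HasSum (fun m : ℤ => ‖A m‖ * b m) s) : ‖W (T u) - T (W u)‖ ≤ s := by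
  have h1 : ∀ x : E, HasSum (fun m : ℤ => A m • S m x) (T x) := fun x => by
    have h := hT.mapL (ContinuousLinearMap.apply ℂ E x)
    simpa only [ContinuousLinearMap.apply_apply, smul_apply] using h
  refine (((h1 u).mapL W).sub (h1 (W u))).norm_le_of_bounded hs fun m => ?_
  rw [map_smul, ← smul_sub, norm_smul]
  gcongr
  exact hb m

theorem potentialOp_comm (V W : EllInftyReal) (u : EllTwo) :
    potentialOp W (potentialOp V u) = potentialOp V (potentialOp W u) := by
  ext n
  rw [potentialOp_apply, potentialOp_apply, potentialOp_apply, potentialOp_apply, mul_left_comm]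

theorem norm_commutator_longRangeOp_le {A : ℤ → ℂ} (hA : Summable fun m => ‖A m‖)
    (V : EllInftyReal) (a R : ℝ) (ha : 0 ≤ a) {s : ℝ}
    (hs : HasSum (fun m : ℤ => ‖A m‖ * (Real.exp (a * |(m : ℝ)|) - 1)) s) (u : EllTwo) :
    ‖potentialOp (expWeight a R ha) (longRangeOp A V u)
      - longRangeOp A V (potentialOp (expWeight a R ha) u)‖
      ≤ s * ‖potentialOp (expWeight a R ha) u‖ := by
  have hsum : Summable fun m : ℤ => A m • shiftOp m := by
    refine Summable.of_norm_bounded hA fun m => ?_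
    rw [norm_smul]
    exact mul_le_of_le_one_right (norm_nonneg _) (norm_shiftOp_le m)
  have h1 := norm_commutator_le_of_hasSum hsum.hasSum (potentialOp (expWeight a R ha)) u
    (fun m => norm_commutator_shiftOp_le a R ha m u)
    (by simpa only [mul_assoc] using hs.mul_right ‖potentialOp (expWeight a R ha) u‖)
  rw [longRangeOp, add_apply, add_apply, map_add, potentialOp_comm, add_sub_add_right_eq_sub]
  exact h1

/-- Combes-Thomas estimate away from the spectrum. -/
theorem norm_apply_le_of_combesThomas {A : ℤ → ℂ} (hA : Summable fun m => ‖A m‖)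
    (V : EllInftyReal) {K : ℝ} (hH : ‖longRangeOp A V‖ ≤ K - 1) {a : ℝ} (ha : 0 < a) {s : ℝ}
    (hs1 : s ≤ 1 / 2)
    (hs : HasSum (fun m : ℤ => ‖A m‖ * (Real.exp (a * |(m : ℝ)|) - 1)) s) {z : ℂ}
    (hz : K ≤ |z.re|) {u φ : EllTwo} (hu : longRangeOp A V u - z • u = φ)
    {r : ℝ} (hr : ∀ n : ℤ, r < |(n : ℝ)| → φ n = 0) (n : ℤ) :
    ‖u n‖ ≤ Real.exp (-a * |(n : ℝ)|) * (Real.exp (a * r) * ‖φ‖) / (|z.re| - K + 1 / 2) := by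
  set H := longRangeOp A V with hHdef
  -- Truncating at `|n|` keeps the weight bounded and leaves its value at `n` equal to `e^{a|n|}`.
  set W := potentialOp (expWeight a |(n : ℝ)| ha.le) with hW
  have h1 := norm_commutator_longRangeOp_le hA V a |(n : ℝ)| ha.le hs u
  have h2 : H (W u) - z • W u = W φ - (W (H u) - H (W u)) := by
    rw [← hu, map_sub, map_smul]; abel
  have h3 : |z.re| * ‖W u‖ ≤ (K - 1) * ‖W u‖ + (‖W φ‖ + s * ‖W u‖) := by
    calc |z.re| * ‖W u‖ ≤ ‖z • W u‖ := by
          rw [norm_smul]; gcongr; exact Complex.abs_re_le_norm z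
      _ = ‖H (W u) - (W φ - (W (H u) - H (W u)))‖ := by rw [← h2]; congr 1; abel
      _ ≤ ‖H (W u)‖ + (‖W φ‖ + ‖W (H u) - H (W u)‖) :=
        (norm_sub_le _ _).trans (add_le_add_right (norm_sub_le _ _) _)
      _ ≤ _ := add_le_add (H.le_of_opNorm_le hH _) (add_le_add_right h1 _)
  have h4 : ‖W φ‖ ≤ Real.exp (a * r) * ‖φ‖ := by
    refine EllTwo.norm_le_of_forall_norm_le (Real.exp_pos _).le fun k => ?_
    rw [hW, potentialOp_apply, norm_mul, Complex.norm_real, expWeight_apply, Real.norm_eq_abs,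
      Real.abs_exp]
    by_cases hk : r < |(k : ℝ)|
    · rw [hr k hk, norm_zero, mul_zero, mul_zero]
    · gcongr
      exact (min_le_left _ _).trans (not_lt.1 hk)
  have h5 : Real.exp (a * |(n : ℝ)|) * ‖u n‖ ≤ ‖W u‖ := by
    have h := norm_apply_le (W u) n
    rwa [hW, potentialOp_apply, norm_mul, Complex.norm_real, expWeight_apply, Real.norm_eq_abs,
      Real.abs_exp, min_self] at h
  -- Of the gap `|Re z| - (K - 1)` the commutator costs at most `1/2`.
  have h6 : (|z.re| - K + 1 / 2) * ‖W u‖ ≤ Real.exp (a * r) * ‖φ‖ := by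
    nlinarith [norm_nonneg (W u)]
  rw [le_div_iff₀ (by linarith)]
  have h7 : (|z.re| - K + 1 / 2) * (Real.exp (a * |(n : ℝ)|) * ‖u n‖)
      ≤ Real.exp (a * r) * ‖φ‖ := (mul_le_mul_of_nonneg_left h5 (by linarith)).trans h6
  calc ‖u n‖ * (|z.re| - K + 1 / 2)
      = Real.exp (-a * |(n : ℝ)|) * ((|z.re| - K + 1 / 2) * (Real.exp (a * |(n : ℝ)|) * ‖u n‖)) := by
        have h8 : Real.exp (-a * |(n : ℝ)|) * Real.exp (a * |(n : ℝ)|) = 1 := by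
          rw [← Real.exp_add, neg_mul, neg_add_cancel, Real.exp_zero]
        linear_combination (-(‖u n‖ * (|z.re| - K + 1 / 2))) * h8
    _ ≤ _ := mul_le_mul_of_nonneg_left h7 (Real.exp_pos _).le

end CombesThomas

/-! ### One resolvent bound for all energies -/

theorem norm_sq_div_le_of_le_abs {x E K D : ℝ} (hK : 1 ≤ K) (hE : K ≤ |E|) (hx0 : 0 ≤ x)
    (hx : x ≤ D / (|E| - K + 1 / 2)) : x ^ 2 ≤ 8 * K ^ 2 * D ^ 2 / (1 + E ^ 2) := by
  have h1 : |E| / (2 * K) ≤ |E| - K + 1 / 2 := by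
    rw [div_le_iff₀ (by positivity)]
    nlinarith
  have hE0 : 0 < |E| := by linarith
  have h2 : 0 < |E| - K + 1 / 2 := by linarith
  have hD : x * (|E| / (2 * K)) ≤ D := by
    rw [le_div_iff₀ h2] at hx
    exact (mul_le_mul_of_nonneg_left h1 hx0).trans hx
  have h3 : x * |E| ≤ 2 * K * D := by
    rw [← mul_div_assoc, div_le_iff₀ (by positivity)] at hD
    linarith
  have h4 : x ^ 2 * E ^ 2 ≤ 4 * K ^ 2 * D ^ 2 := by
    have := pow_le_pow_left₀ (by positivity) h3 2
    rw [mul_pow, sq_abs] at this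
    linarith
  have h5 : 1 ≤ E ^ 2 := by rw [← sq_abs]; nlinarith
  rw [le_div_iff₀ (by positivity)]
  nlinarith [sq_nonneg x]

theorem exists_bound_laplaceVector (φ : EllTwo) {r : ℝ} (hr : ∀ n : ℤ, r < |(n : ℝ)| → φ n = 0)
    {K C₁ c₁ c₂ : ℝ} (hK : 1 ≤ K) (hC₁ : 0 ≤ C₁) (hc₂ : 0 < c₂) (hc₂₁ : c₂ ≤ c₁) :
    ∃ C a : ℝ, 0 ≤ C ∧ 0 < a ∧ ∀ (A : ℤ → ℂ) (V : EllInftyReal),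
      (∀ m : ℤ, conj (A m) = A (-m)) →
      (∀ m : ℤ, ‖A m‖ ≤ C₁ * Real.exp (-c₁ * |(m : ℝ)|)) →
      ‖longRangeOp A V‖ ≤ K - 1 →
      ∀ N : ℤ, N ≠ 0 → 4 * r < |(N : ℝ)| → ∀ η : ℝ, 0 < η → η ≤ 1 → ∀ L : ℝ, 0 < L →
      (∀ E : ℝ, |E| ≤ K → ∃ I : Finset ℤ, IsIntervalTowards N I ∧ L ≤ (I.card : ℝ) ∧
        GreenDecay A V I ((E : ℂ) + (η : ℂ) * Complex.I) c₂) →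
      ∀ E : ℝ, ‖laplaceVector (longRangeOp A V) φ ((E : ℂ) + (η : ℂ) * Complex.I) N‖ ^ 2
        ≤ C * (η⁻¹ ^ 5 * Real.exp (-(c₂ / 10) * L) + Real.exp (-(2 * a) * |(N : ℝ)|))
          / (1 + E ^ 2) := by
  have hc₁ : 0 < c₁ := hc₂.trans_le hc₂₁
  obtain ⟨a, ha, hA₀⟩ := exists_combesThomas_rate hC₁ hc₁
  set Cg := C₁ * (expSum (c₁ / 2) * (C₁ * expSum (c₁ / 2) + 1)) ^ 2 * (200 / c₂ ^ 2) * ‖φ‖ ^ 2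
    with hCg
  have hCg0 : 0 ≤ Cg := by positivity
  set D := Real.exp (a * r) * ‖φ‖ with hD
  -- The factor `1 + K²` turns the bound on `|E| ≤ K` into the profile `1/(1+E²)`; the second term
  -- serves `|E| ≥ K`.
  refine ⟨Cg * (1 + K ^ 2) + 8 * K ^ 2 * D ^ 2, a, by positivity, ha, ?_⟩
  intro A V hAs hA hH N hN0 hN η hη hη1 L hL hI E
  set z : ℂ := (E : ℂ) + (η : ℂ) * Complex.I with hz
  have hzim : z.im = η := by simp [hz]
  have hzre : z.re = E := by simp [hz]
  have hu := apply_laplaceVector (isSelfAdjoint_longRangeOp hAs V) φ (z := z) (by rwa [hzim])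
  set u := laplaceVector (longRangeOp A V) φ z
  set G := η⁻¹ ^ 5 * Real.exp (-(c₂ / 10) * L) with hG
  set F := Real.exp (-(2 * a) * |(N : ℝ)|) with hF
  have hG0 : 0 ≤ G := by positivity
  have hF0 : 0 ≤ F := by positivity
  rcases le_total |E| K with hE | hE
  · obtain ⟨I, hI1, hI2, hI3⟩ := hI E hE
    have hne : I.Nonempty := by
      rw [← Finset.card_pos]
      exact_mod_cast hL.trans_le hI2
    have h1 := norm_sq_apply_le_of_isIntervalTowards hAs hC₁ hc₂ hc₂₁ hA V (by rwa [hzim])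
      (by rwa [hzim]) hu hr hN0 hN hne hI1 hI3
    rw [hzim] at h1
    have h2 : ‖u N‖ ^ 2 ≤ Cg * G := by
      refine h1.trans (le_trans ?_ (mul_assoc Cg _ _).le)
      have h2 : -(c₂ / 10) * (I.card : ℝ) ≤ -(c₂ / 10) * L := by
        linarith [mul_le_mul_of_nonneg_left hI2 (by positivity : 0 ≤ c₂ / 10)]
      gcongr
    have h3 : E ^ 2 ≤ K ^ 2 := sq_le_sq' (by linarith [(abs_le.1 hE).1]) (abs_le.1 hE).2
    rw [le_div_iff₀ (by positivity)]
    calc ‖u N‖ ^ 2 * (1 + E ^ 2) ≤ Cg * G * (1 + K ^ 2) := by gcongr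
      _ = Cg * (1 + K ^ 2) * G := by ring
      _ ≤ _ := by
        gcongr
        · exact le_add_of_nonneg_right (by positivity)
        · exact le_add_of_nonneg_right hF0
  · obtain ⟨s, hs1, hs⟩ := hA₀ A hA
    have h1 := norm_apply_le_of_combesThomas (summable_norm_hopping hc₁ hA) V hH ha hs1 hs
      (z := z) (by rwa [hzre]) hu hr N
    rw [hzre] at h1
    refine (norm_sq_div_le_of_le_abs hK hE (norm_nonneg _) h1).trans ?_
    have h2 : Real.exp (-a * |(N : ℝ)|) ^ 2 = F := by
      rw [hF, ← Real.exp_nat_mul]; push_cast; ring_nf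
    rw [mul_pow, h2]
    refine div_le_div_of_nonneg_right ?_ (by positivity)
    calc 8 * K ^ 2 * (F * D ^ 2) = 8 * K ^ 2 * D ^ 2 * F := by ring
      _ ≤ _ := by
        gcongr
        · exact le_add_of_nonneg_left (by positivity)
        · exact le_add_of_nonneg_left hG0

/-! ### From time averages to energy integrals -/

section Parseval
open MeasureTheory FourierTransform

theorem laplaceVector_apply {H : EllTwo →L[ℂ] EllTwo} (hH : IsSelfAdjoint H)
    (φ : EllTwo) {z : ℂ} (hz : 0 < z.im) (n : ℤ) :
    laplaceVector H φ z n = Complex.I * ∫ t in Set.Ioi (0 : ℝ),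
      Complex.exp (Complex.I * z * t) * schrodingerEvolution H φ t n := by
  have h := (lp.evalCLM ℂ (fun _ : ℤ => ℂ) 2 n).integral_comp_comm
    (integrableOn_laplace_integrand hH φ hz)
  rw [laplaceVector]
  change Complex.I * (lp.evalCLM ℂ (fun _ : ℤ => ℂ) 2 n) _ = _
  rw [← h]
  rfl

theorem continuous_schrodingerEvolution_apply (H : EllTwo →L[ℂ] EllTwo) (φ : EllTwo) (n : ℤ) :
    Continuous fun t => schrodingerEvolution H φ t n :=
  (lp.evalCLM ℂ (fun _ : ℤ => ℂ) 2 n).continuous.comp (continuous_schrodingerEvolution H φ)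

/-- The time average of `|ψ_n(t)|²` as an integral over energies. -/
theorem lintegral_schrodingerEvolution_eq {H : EllTwo →L[ℂ] EllTwo} (hH : IsSelfAdjoint H)
    (φ : EllTwo) {η : ℝ} (hη : 0 < η) (n : ℤ) :
    ∫⁻ t in Set.Ioi (0 : ℝ), ENNReal.ofReal
        (Real.exp (-(2 * η) * t) * ‖schrodingerEvolution H φ t n‖ ^ 2)
      = ∫⁻ ξ : ℝ, ENNReal.ofReal
        (‖laplaceVector H φ (((-(2 * Real.pi * ξ) : ℝ) : ℂ) + (η : ℂ) * Complex.I) n‖ ^ 2) := by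
  -- The Fourier transform of this damped, cut-off evolution at `ξ` is, up to a factor of modulus 1,
  -- the resolvent at `-2πξ + iη`. Integrating over `ξ` instead of the energy avoids a constant.
  set g : ℝ → ℂ := fun t => (Real.exp (-η * t) : ℂ) * schrodingerEvolution H φ t n with hg
  set f : ℝ → ℂ := (Set.Ioi (0 : ℝ)).indicator g with hf
  have hgc : Continuous g := by
    have := continuous_schrodingerEvolution_apply H φ n
    fun_prop
  have hgn : ∀ t, ‖g t‖ = Real.exp (-η * t) * ‖schrodingerEvolution H φ t n‖ := fun t => by
    rw [hg]; dsimp only; rw [norm_mul, Complex.norm_real, Real.norm_eq_abs, Real.abs_exp]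
  have hgle : ∀ t, ‖g t‖ ≤ Real.exp (-η * t) * ‖φ‖ := fun t => by
    rw [hgn, ← norm_schrodingerEvolution hH φ t]
    gcongr
    exact norm_apply_le _ n
  have hfi : Integrable f := by
    rw [hf, integrable_indicator_iff measurableSet_Ioi]
    exact Integrable.mono' ((exp_neg_integrableOn_Ioi 0 hη).mul_const ‖φ‖)
      hgc.aestronglyMeasurable (Filter.Eventually.of_forall hgle)
  have hf2 : MemLp f 2 := by
    rw [memLp_two_iff_integrable_sq_norm hfi.aestronglyMeasurable]
    have h1 : (fun t => ‖f t‖ ^ 2) = (Set.Ioi (0 : ℝ)).indicator fun t => ‖g t‖ ^ 2 := by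
      funext t
      by_cases ht : t ∈ Set.Ioi (0 : ℝ) <;> simp [hf, ht]
    rw [h1, integrable_indicator_iff measurableSet_Ioi]
    refine Integrable.mono' ((exp_neg_integrableOn_Ioi 0 (b := 2 * η) (by positivity)).mul_const
      (‖φ‖ ^ 2)) (by fun_prop) (Filter.Eventually.of_forall fun t => ?_)
    rw [Real.norm_eq_abs, abs_of_nonneg (by positivity)]
    refine (pow_le_pow_left₀ (norm_nonneg _) (hgle t) 2).trans_eq ?_
    rw [mul_pow, ← Real.exp_nat_mul]
    push_cast; ring_nf
  have hsq : ∀ w : ℂ, ‖w‖ₑ ^ 2 = ENNReal.ofReal (‖w‖ ^ 2) := fun w => by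
    rw [← ofReal_norm, ENNReal.ofReal_pow (norm_nonneg _)]
  have h1 := lintegral_enorm_sq_fourier hfi hf2
  have h2 : ∫⁻ t, ‖f t‖ₑ ^ 2 = ∫⁻ t in Set.Ioi (0 : ℝ), ENNReal.ofReal
      (Real.exp (-(2 * η) * t) * ‖schrodingerEvolution H φ t n‖ ^ 2) := by
    rw [← lintegral_indicator measurableSet_Ioi]
    refine lintegral_congr fun t => ?_
    by_cases ht : t ∈ Set.Ioi (0 : ℝ)
    · rw [hf, Set.indicator_of_mem ht, Set.indicator_of_mem ht, hsq, hgn, mul_pow,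
        ← Real.exp_nat_mul]
      push_cast; ring_nf
    · rw [hf, Set.indicator_of_notMem ht, Set.indicator_of_notMem ht]; simp
  rw [← h2, ← h1]
  refine lintegral_congr fun ξ => ?_
  rw [hsq, laplaceVector_apply hH φ (by simpa using hη), norm_mul, Complex.norm_I, one_mul]
  congr 3
  rw [Real.fourier_eq', ← integral_indicator measurableSet_Ioi]
  refine integral_congr_ae (Filter.Eventually.of_forall fun t => ?_)
  dsimp only
  by_cases ht : t ∈ Set.Ioi (0 : ℝ)
  · rw [hf, Set.indicator_of_mem ht, Set.indicator_of_mem ht, hg]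
    dsimp only
    rw [smul_eq_mul, ← mul_assoc, Complex.ofReal_exp, ← Complex.exp_add]
    congr 2
    simp only [RCLike.inner_apply, conj_trivial]
    push_cast
    linear_combination (-(η : ℂ) * t) * Complex.I_sq
  · rw [hf, Set.indicator_of_notMem ht, Set.indicator_of_notMem ht, smul_zero]

theorem lintegral_div_one_add_sq_le {B : ℝ} (hB : 0 ≤ B) :
    ∫⁻ ξ : ℝ, ENNReal.ofReal (B / (1 + (-(2 * Real.pi * ξ)) ^ 2))
      ≤ ENNReal.ofReal (B * Real.pi) := by
  calc ∫⁻ ξ : ℝ, ENNReal.ofReal (B / (1 + (-(2 * Real.pi * ξ)) ^ 2))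
      ≤ ∫⁻ ξ : ℝ, ENNReal.ofReal (B * (1 + ξ ^ 2)⁻¹) := by
        refine lintegral_mono fun ξ => ENNReal.ofReal_le_ofReal ?_
        rw [div_eq_mul_inv]
        have h : 1 ≤ 4 * Real.pi ^ 2 := by nlinarith [Real.pi_gt_three]
        refine mul_le_mul_of_nonneg_left (inv_anti₀ (by positivity) ?_) hB
        nlinarith [mul_le_mul_of_nonneg_right h (sq_nonneg ξ)]
    _ = ENNReal.ofReal (∫ ξ : ℝ, B * (1 + ξ ^ 2)⁻¹) :=
        (ofReal_integral_eq_lintegral_ofReal (integrable_inv_one_add_sq.const_mul B)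
          (Filter.Eventually.of_forall fun ξ => by positivity)).symm
    _ = _ := by rw [integral_const_mul, integral_univ_inv_one_add_sq]

end Parseval

/-! ### Splitting the time-averaged moment -/

section Moments
open MeasureTheory

theorem averagedMoment_eq_tsum (H : EllTwo →L[ℂ] EllTwo) (φ : EllTwo) (p T : ℝ) :
    averagedMoment H φ p T = ∑' n : ℤ, ENNReal.ofReal (|(n : ℝ)| ^ p) *
      (ENNReal.ofReal (2 / T) * ∫⁻ t in Set.Ioi (0 : ℝ), ENNReal.ofReal
        (Real.exp (-(2 * (1 / T)) * t) * ‖schrodingerEvolution H φ t n‖ ^ 2)) := by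
  have hm : ∀ n : ℤ, Measurable fun t : ℝ => ENNReal.ofReal
      (Real.exp (-(2 * (1 / T)) * t) * ‖schrodingerEvolution H φ t n‖ ^ 2) := fun n => by
    have := continuous_schrodingerEvolution_apply H φ n
    exact (by fun_prop : Continuous fun t : ℝ =>
      Real.exp (-(2 * (1 / T)) * t) * ‖schrodingerEvolution H φ t n‖ ^ 2).measurable.ennreal_ofReal
  simp_rw [mul_left_comm (ENNReal.ofReal (|_| ^ p)), ← lintegral_const_mul _ (hm _)]
  rw [ENNReal.tsum_mul_left, ← lintegral_tsum fun n => ((hm n).const_mul _).aemeasurable]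
  rw [averagedMoment]
  congr 1
  refine lintegral_congr fun t => ?_
  rw [← ENNReal.tsum_mul_left]
  refine tsum_congr fun n => ?_
  rw [← ENNReal.ofReal_mul (Real.exp_pos _).le, ← ENNReal.ofReal_mul (by positivity)]
  congr 1
  have : -2 * t / T = -(2 * (1 / T)) * t := by ring
  rw [this]
  ring

theorem tsum_timeAverage_eq {H : EllTwo →L[ℂ] EllTwo} (hH : IsSelfAdjoint H) (φ : EllTwo) {T : ℝ}
    (hT : 0 < T) :
    ∑' n : ℤ, (ENNReal.ofReal (2 / T) * ∫⁻ t in Set.Ioi (0 : ℝ), ENNReal.ofReal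
        (Real.exp (-(2 * (1 / T)) * t) * ‖schrodingerEvolution H φ t n‖ ^ 2))
      = ENNReal.ofReal (‖φ‖ ^ 2) := by
  have hm : ∀ n : ℤ, Measurable fun t : ℝ => ENNReal.ofReal
      (Real.exp (-(2 * (1 / T)) * t) * ‖schrodingerEvolution H φ t n‖ ^ 2) := fun n => by
    have := continuous_schrodingerEvolution_apply H φ n
    exact (by fun_prop : Continuous fun t : ℝ =>
      Real.exp (-(2 * (1 / T)) * t) * ‖schrodingerEvolution H φ t n‖ ^ 2).measurable.ennreal_ofReal
  rw [ENNReal.tsum_mul_left, ← lintegral_tsum fun n => (hm n).aemeasurable]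
  have h1 : ∀ t : ℝ, ∑' n : ℤ, ENNReal.ofReal
      (Real.exp (-(2 * (1 / T)) * t) * ‖schrodingerEvolution H φ t n‖ ^ 2)
      = ENNReal.ofReal (Real.exp (-(2 * (1 / T)) * t) * ‖φ‖ ^ 2) := fun t => by
    rw [← ENNReal.ofReal_tsum_of_nonneg (fun _ => by positivity)
      ((schrodingerEvolution H φ t).summable_sq.mul_left _), tsum_mul_left, ← EllTwo.norm_sq,
      norm_schrodingerEvolution hH]
  simp_rw [h1]
  have hb : 0 < 2 * (1 / T) := by positivity
  rw [← ofReal_integral_eq_lintegral_ofReal ((exp_neg_integrableOn_Ioi 0 hb).mul_const _)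
    (Filter.Eventually.of_forall fun t => by positivity), integral_mul_const,
    integral_exp_mul_Ioi (by linarith), ← ENNReal.ofReal_mul (by positivity)]
  congr 1
  rw [mul_zero, Real.exp_zero]
  field_simp

/-- For `|n| ≤ M` the weight is at most `M^p` and the total averaged mass is `‖φ‖²` by unitarity;
the other sites are summed by `hb`. -/
theorem averagedMoment_le {H : EllTwo →L[ℂ] EllTwo} (hH : IsSelfAdjoint H) (φ : EllTwo)
    {p T M B : ℝ} (hp : 0 < p) (hT : 0 < T) (hM : 0 ≤ M) (hB : 0 ≤ B) {s : ℤ → ℝ}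
    (hs0 : ∀ n, 0 ≤ s n) (hs : Summable fun n : ℤ => |(n : ℝ)| ^ p * s n)
    (hb : ∀ n : ℤ, M < |(n : ℝ)| → ∫⁻ t in Set.Ioi (0 : ℝ), ENNReal.ofReal
        (Real.exp (-(2 * (1 / T)) * t) * ‖schrodingerEvolution H φ t n‖ ^ 2)
          ≤ ENNReal.ofReal (B * s n)) :
    averagedMoment H φ p T
      ≤ ENNReal.ofReal (M ^ p * ‖φ‖ ^ 2 + 2 / T * B * ∑' n : ℤ, |(n : ℝ)| ^ p * s n) := by
  rw [averagedMoment_eq_tsum, ENNReal.ofReal_add (by positivity)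
    (mul_nonneg (by positivity) (tsum_nonneg fun n => mul_nonneg (by positivity) (hs0 n))),
    ENNReal.ofReal_mul (by positivity), ← tsum_timeAverage_eq hH φ hT, ← ENNReal.tsum_mul_left,
    ← tsum_mul_left, ENNReal.ofReal_tsum_of_nonneg
      (fun n => mul_nonneg (by positivity) (mul_nonneg (by positivity) (hs0 n)))
      (hs.mul_left _), ← ENNReal.tsum_add]
  refine ENNReal.tsum_le_tsum fun n => ?_
  rcases le_or_gt |(n : ℝ)| M with h | h
  · refine le_add_right ?_
    gcongr
  · refine le_add_left ?_
    calc _ ≤ ENNReal.ofReal (|(n : ℝ)| ^ p) * (ENNReal.ofReal (2 / T) *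
          ENNReal.ofReal (B * s n)) := by gcongr; exact hb n h
      _ = _ := by
        rw [← ENNReal.ofReal_mul (by positivity), ← ENNReal.ofReal_mul (by positivity)]
        congr 1
        ring

end Moments

/-! ### Growth comparisons and the final choice of scale -/

section Asymptotics
open Filter

theorem eventually_mul_le_mul_rpow {b q : ℝ} (hb : 0 < b) (hq : 1 < q) (c : ℝ) :
    ∀ᶠ y : ℝ in atTop, c * y ≤ b * y ^ q := by
  filter_upwards [(tendsto_rpow_atTop (sub_pos.2 hq)).eventually_ge_atTop (c / b),
    eventually_gt_atTop 0] with y h1 h2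
  rw [div_le_iff₀ hb] at h1
  have h3 : y ^ q = y ^ (q - 1) * y := by rw [← Real.rpow_add_one h2.ne', sub_add_cancel]
  rw [h3, ← mul_assoc, mul_comm b]
  gcongr

theorem summable_int_abs_of_eventually {f : ℝ → ℝ} (hf0 : ∀ x, 0 ≤ x → 0 ≤ f x)
    (hf : ∀ᶠ x : ℝ in atTop, x ^ 2 * f x ≤ 1) : Summable fun n : ℤ => f |(n : ℝ)| := by
  have h : Summable fun n : ℕ => f n := by
    refine Summable.of_norm_bounded_eventually_nat (Real.summable_one_div_nat_pow.2 one_lt_two) ?_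
    filter_upwards [tendsto_natCast_atTop_atTop.eventually hf, eventually_gt_atTop 0] with n h1 h2
    have h3 : (0 : ℝ) < n := by exact_mod_cast h2
    rw [Real.norm_eq_abs, abs_of_nonneg (hf0 _ h3.le), le_div_iff₀ (by positivity)]
    linarith
  exact Summable.of_nat_of_neg (by simpa using h) (by simpa using h)

theorem summable_rpow_mul_exp_neg_log_rpow (p : ℝ) {b q : ℝ} (hb : 0 < b) (hq : 1 < q) :
    Summable fun n : ℤ => |(n : ℝ)| ^ p * Real.exp (-b * Real.log |(n : ℝ)| ^ q) := by
  refine summable_int_abs_of_eventually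
    (f := fun x => x ^ p * Real.exp (-b * Real.log x ^ q)) (fun x _ => by positivity) ?_
  filter_upwards [Real.tendsto_log_atTop.eventually (eventually_mul_le_mul_rpow hb hq (2 + p)),
    eventually_gt_atTop 0] with x h1 h2
  rw [Real.rpow_def_of_pos h2, ← Real.exp_add]
  nth_rewrite 1 [← Real.exp_log h2]
  rw [← Real.exp_nat_mul, ← Real.exp_add, Real.exp_le_one_iff]
  push_cast
  linarith

theorem summable_rpow_mul_exp_neg_abs (p : ℝ) {b : ℝ} (hb : 0 < b) :
    Summable fun n : ℤ => |(n : ℝ)| ^ p * Real.exp (-b * |(n : ℝ)|) := by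
  refine summable_int_abs_of_eventually
    (f := fun x => x ^ p * Real.exp (-b * x)) (fun x _ => by positivity) ?_
  filter_upwards [(tendsto_rpow_mul_exp_neg_mul_atTop_nhds_zero (2 + p) b hb).eventually_le_const
    one_pos, eventually_gt_atTop 0] with x h1 h2
  rw [Real.rpow_add h2, Real.rpow_two, mul_assoc] at h1
  exact h1

/-- The exponent `(δ+ε)/δ` exceeds 1 because `ε > 0`. The shift `d` costs only a factor
`(1/2)^{1/δ}` once `(log T)^{δ+ε} ≥ 2d`. -/
theorem eventually_mul_log_le {δ ε b : ℝ} (hδ : 0 < δ) (hε : 0 < ε) (hb : 0 < b) (c d : ℝ) :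
    ∀ᶠ T : ℝ in atTop, c * Real.log T ≤ b * (Real.log T ^ (δ + ε) - d) ^ (1 / δ) := by
  refine Real.tendsto_log_atTop.eventually (p := fun y =>
    c * y ≤ b * (y ^ (δ + ε) - d) ^ (1 / δ)) ?_
  have hq : 1 < (δ + ε) * (1 / δ) := by
    rw [mul_one_div, lt_div_iff₀ hδ]; linarith
  have hb' : 0 < b * (1 / 2 : ℝ) ^ (1 / δ) := by positivity
  filter_upwards [eventually_mul_le_mul_rpow hb' hq c, eventually_gt_atTop 0,
    (tendsto_rpow_atTop (add_pos hδ hε)).eventually_ge_atTop (2 * d)] with y h1 h2 h3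
  refine h1.trans ?_
  rw [Real.rpow_mul h2.le, mul_assoc, ← Real.mul_rpow (by positivity) (by positivity)]
  gcongr
  linarith

end Asymptotics

end LongRange

open Filter in
theorem corollary3p4
    (φ : EllTwo) (hφ : (Function.support fun n : ℤ => φ n).Finite)
    (K C₁ c₁ c₂ ε₀ p δ ε : ℝ) (N₀ : ℕ)
    (hK : 3 ≤ K) (hC₁ : 0 < C₁) (hc₂ : 0 < c₂) (hc₂₁ : c₂ ≤ c₁) (hε₀ : 0 < ε₀)
    (hp : 0 < p) (hδ : 0 < δ) (hδ₁ : δ < 1) (hε : 0 < ε) :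
    ∃ T₃ : ℝ, 0 < T₃ ∧
      ∀ (A : ℤ → ℂ) (V : EllInftyReal),
        (∀ m : ℤ, (starRingEnd ℂ) (A m) = A (-m)) →
        (∀ m : ℤ, ‖A m‖ ≤ C₁ * Real.exp (-c₁ * |(m : ℝ)|)) →
        spectrum ℂ (longRangeOp A V) ⊆
          (fun x : ℝ => (x : ℂ)) '' Set.Icc (-K + 1) (K - 1) →
        (∀ N : ℤ, (N₀ : ℝ) ≤ |(N : ℝ)| →
          ∀ E η : ℝ, |E| ≤ K → 0 < η → η ≤ ε₀ →
            ∃ I : Finset ℤ, IsIntervalTowards N I ∧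
              (Real.log |(N : ℝ)|) ^ (1 / δ) ≤ (I.card : ℝ) ∧
              GreenDecay A V I ((E : ℂ) + (η : ℂ) * Complex.I) c₂) →
        ∀ T : ℝ, T₃ ≤ T →
          averagedMoment (longRangeOp A V) φ p T ≤
            ENNReal.ofReal (Real.exp (p * (Real.log T) ^ (δ + ε))) := by
  obtain ⟨r, hr⟩ : ∃ r : ℝ, ∀ n : ℤ, r < |(n : ℝ)| → φ n = 0 := by
    obtain ⟨r, hr⟩ := (hφ.image fun n : ℤ => |(n : ℝ)|).bddAbove
    refine ⟨r, fun n hn => ?_⟩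
    by_contra h
    exact absurd (hr ⟨n, h, rfl⟩) (not_le.2 hn)
  obtain ⟨C, a, hC, ha, hbound⟩ :=
    exists_bound_laplaceVector φ hr (by linarith : 1 ≤ K) hC₁.le hc₂ hc₂₁
  have hq : 1 < 1 / δ := by rwa [lt_div_iff₀ hδ, one_mul]
  set κ := c₂ / 10 with hκdef
  have hκ : 0 < κ := by positivity
  -- Only half of the rate `κ` is kept; the other half will absorb `T⁵`.
  set s : ℤ → ℝ := fun n => Real.exp (-(κ / 2) * Real.log |(n : ℝ)| ^ (1 / δ))
    + Real.exp (-(2 * a) * |(n : ℝ)|) with hs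
  have hs0 : ∀ n, 0 ≤ s n := fun n => by positivity
  have hsum : Summable fun n : ℤ => |(n : ℝ)| ^ p * s n := by
    simp_rw [hs, mul_add]
    exact (summable_rpow_mul_exp_neg_log_rpow p (half_pos hκ) hq).add
      (summable_rpow_mul_exp_neg_abs p (by positivity))
  set S := ∑' n : ℤ, |(n : ℝ)| ^ p * s n with hS
  -- Chosen so that `e^{p c₀} = ‖φ‖² + 1`: lowering the logarithm of the cutoff by `c₀` makes the
  -- final bound hold without a constant.
  set c₀ := Real.log (‖φ‖ ^ 2 + 1) / p with hc₀
  set M₀ : ℝ := max 2 (max N₀ (4 * r)) with hM₀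
  have hM₀2 : 2 ≤ M₀ := le_max_left _ _
  obtain ⟨T₀, hT₀⟩ := eventually_atTop.1
    ((eventually_mul_log_le hδ hε (half_pos hκ) 5 c₀).and
      (((tendsto_rpow_atTop (add_pos hδ hε)).comp Real.tendsto_log_atTop).eventually_ge_atTop
        (Real.log M₀ + c₀)))
  -- The last three entries ensure `η ≤ 1`, `η ≤ ε₀`, and a tail contribution of at most 1.
  refine ⟨max T₀ (max 1 (max (1 / ε₀) (2 * (C * Real.pi) * S))), by positivity, ?_⟩
  intro A V hAs hA hspec hI T hT
  rw [max_le_iff, max_le_iff, max_le_iff] at hT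
  obtain ⟨hTT₀, hT1, hTε, hTS⟩ := hT
  obtain ⟨hlog, hM⟩ := hT₀ T hTT₀
  have hTpos : 0 < T := by linarith
  set y := Real.log T ^ (δ + ε) - c₀ with hy
  have hyM : M₀ ≤ Real.exp y := by
    rw [← Real.log_le_iff_le_exp (by linarith)]
    have : Real.log M₀ + c₀ ≤ Real.log T ^ (δ + ε) := hM
    linarith
  have hH : IsSelfAdjoint (longRangeOp A V) := isSelfAdjoint_longRangeOp hAs V
  have hHn : ‖longRangeOp A V‖ ≤ K - 1 := by
    refine norm_le_of_spectrum_subset hH (by linarith) ?_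
    rwa [show -(K - 1) = -K + 1 by ring]
  have hη : 0 < 1 / T := by positivity
  have key : ∀ n : ℤ, Real.exp y < |(n : ℝ)| → ∫⁻ t in Set.Ioi (0 : ℝ), ENNReal.ofReal
      (Real.exp (-(2 * (1 / T)) * t) * ‖schrodingerEvolution (longRangeOp A V) φ t n‖ ^ 2)
        ≤ ENNReal.ofReal (C * Real.pi * s n) := by
    intro n hn
    have hnM : M₀ < |(n : ℝ)| := hyM.trans_lt hn
    have hn2 : 2 < |(n : ℝ)| := hM₀2.trans_lt hnM
    have hnN₀ : (N₀ : ℝ) ≤ |(n : ℝ)| :=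
      ((le_max_left _ _).trans (le_max_right _ _)).trans hnM.le
    have hnr : 4 * r < |(n : ℝ)| := ((le_max_right _ _).trans (le_max_right _ _)).trans_lt hnM
    have hn0 : n ≠ 0 := by
      rintro rfl
      norm_num at hn2
    have hlogn : 0 < Real.log |(n : ℝ)| := Real.log_pos (by linarith)
    have hLpos : 0 < Real.log |(n : ℝ)| ^ (1 / δ) := Real.rpow_pos_of_pos hlogn _
    have hb := hbound A V hAs hA hHn n hn0 hnr (1 / T) hη
      (by rw [div_le_iff₀ hTpos]; linarith) _ hLpos
      (fun E hE => hI n hnN₀ E (1 / T) hE hη (one_div_le hε₀ hTpos |>.1 hTε))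
    have hsn : (1 / T)⁻¹ ^ 5 * Real.exp (-κ * Real.log |(n : ℝ)| ^ (1 / δ))
        + Real.exp (-(2 * a) * |(n : ℝ)|) ≤ s n := by
      refine add_le_add_left ?_ _
      rw [one_div, inv_inv]
      nth_rewrite 1 [← Real.exp_log hTpos]
      rw [← Real.exp_nat_mul, ← Real.exp_add, Real.exp_le_exp]
      have hy0 : 0 ≤ y := Real.one_le_exp_iff.1 (by linarith)
      have hyn : y ≤ Real.log |(n : ℝ)| := by
        rw [Real.le_log_iff_exp_le (by linarith)]
        exact hn.le
      have h1 : y ^ (1 / δ) ≤ Real.log |(n : ℝ)| ^ (1 / δ) := by gcongr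
      have h2 := mul_le_mul_of_nonneg_left h1 (half_pos hκ).le
      push_cast
      linarith
    rw [lintegral_schrodingerEvolution_eq hH φ hη n]
    calc _ ≤ ∫⁻ ξ : ℝ, ENNReal.ofReal (C * s n / (1 + (-(2 * Real.pi * ξ)) ^ 2)) := by
          refine MeasureTheory.lintegral_mono fun ξ => ENNReal.ofReal_le_ofReal ?_
          refine (hb (-(2 * Real.pi * ξ))).trans ?_
          gcongr
      _ ≤ ENNReal.ofReal (C * s n * Real.pi) :=
          lintegral_div_one_add_sq_le (mul_nonneg hC (hs0 n))
      _ = _ := by rw [mul_right_comm]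
  refine (averagedMoment_le hH φ hp hTpos (Real.exp_pos y).le (by positivity) hs0 hsum key).trans
    (ENNReal.ofReal_le_ofReal ?_)
  have h1 : 2 / T * (C * Real.pi) * S ≤ 1 := by
    rw [div_mul_eq_mul_div, div_mul_eq_mul_div, div_le_iff₀ hTpos, one_mul]
    exact hTS
  have h2 : 1 ≤ Real.exp y ^ p := Real.one_le_rpow (by linarith) hp.le
  have h3 : Real.exp y ^ p * (‖φ‖ ^ 2 + 1) = Real.exp (p * Real.log T ^ (δ + ε)) := by
    have h4 : ‖φ‖ ^ 2 + 1 = Real.exp (p * c₀) := by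
      rw [hc₀, mul_div_cancel₀ _ hp.ne', Real.exp_log (by positivity)]
    rw [h4, ← Real.exp_mul, ← Real.exp_add, hy]
    ring_nf
  rw [← h3]
  linarith
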